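/- An orderon is a symmetric Lebesgue measurable function $W\colon([0,1]^2)^2\to[0,1]$. For a measure preserving bijection $f$ of $[0,1]^2$ (whose inverse is also measure preserving) put $W^f(v,w)=W(f(v),f(w))$ and $\mathrm{Shift}(f)=\sup_{(x,a)\in[0,1]^2}|x-\pi_1(f(x,a))|$, where $\pi_1$ is the projection to the first coordinate. Let $\|H\|_\square=\sup_{S,T}\left|\int_{S\times T}H\right|$, the supremum being over Lebesgue measurable $S,T\subseteq[0,1]^2$. The cut-shift distance of orderons, a pseudometric, is $$d_\triangle(W,U)=\inf_f\left(\mathrm{Shift}(f)+\|W-U^f\|_\square\right),$$ the infimum being over all measure preserving bijections $f$ of $[0,1]^2$. For a simple ordered graph $G$ on $[n]$, $n\ge1$ (a symmetric $G\colon[n]^2\to\{0,1\}$ with $G(i,i)=0$ for all $i$), let $W_G((x,a),(y,b))=G(Q_n(x),Q_n(y))$, where $Q_n(x)=\lceil nx\rceil$ for $x>0$ and $Q_n(0)=1$. There is a function $\eta\colon(0,\infty)\to\mathbb R$ with $\eta(\varepsilon)\to0$ as $\varepsilon\to0^+$ such that for every orderon $W$ and every $\varepsilon>0$ there exists a simple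 ordered graph $G$ on at most $2^{\varepsilon^{-3+\eta(\varepsilon)}}$ vertices (and at least one vertex) with $d_\triangle(W,W_G)\le\varepsilon$. In particular, the set of the orderons $W_G$, over all simple ordered graphs $G$, is dense in the space of orderons with respect to $d_\triangle$. -/

import Mathlib

open MeasureTheory Set Filter Topology

noncomputable section

/-- The unit square `[0,1]²`, carrying two-dimensional Lebesgue measure `volume`. A point `(x, a)`
is a "vertex" located at position `x` of the linear order. -/
abbrev UnitSquare : Type := unitInterval × unitInterval

/-- An orderon: a symmetric Lebesgue measurable function `([0,1]²)² → [0,1]`.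
`NullMeasurable _ volume` is measurability with respect to the Lebesgue (completed) σ-algebra. -/
structure Orderon where
  toFun : UnitSquare × UnitSquare → ℝ
  measurable' : NullMeasurable toFun volume
  symm' : ∀ v w : UnitSquare, toFun (v, w) = toFun (w, v)
  mem_Icc' : ∀ p : UnitSquare × UnitSquare, toFun p ∈ Set.Icc (0 : ℝ) 1

/-- A map of the unit square to itself is measure preserving if the preimage of every Lebesgue
measurable set is Lebesgue measurable and of the same measure. -/
def LebesguePreserving (g : UnitSquare → UnitSquare) : Prop :=
  ∀ X : Set UnitSquare, NullMeasurableSet X volume →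
    NullMeasurableSet (g ⁻¹' X) volume ∧ volume (g ⁻¹' X) = volume X

/-- A measure preserving bijection of the unit square: a bijection that is measure preserving and
whose inverse is measure preserving. -/
structure MPBijection extends UnitSquare ≃ UnitSquare where
  preserving : LebesguePreserving toFun
  preserving_inv : LebesguePreserving invFun

theorem LebesguePreserving.aemeasurable {g : UnitSquare → UnitSquare}
    (hg : LebesguePreserving g) : AEMeasurable g volume := by
  have h : NullMeasurable g (volume : Measure UnitSquare) := fun s hs =>
    (hg s hs.nullMeasurableSet).1
  exact h.aemeasurable

theorem LebesguePreserving.map_eq {g : UnitSquare → UnitSquare}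
    (hg : LebesguePreserving g) : Measure.map g volume = volume := by
  ext s hs
  rw [Measure.map_apply_of_aemeasurable hg.aemeasurable hs]
  exact (hg s hs.nullMeasurableSet).2

/-- The diagonal action of a measure preserving map agrees almost everywhere with a Borel
measure preserving map of `([0,1]²)²`. -/
theorem LebesguePreserving.exists_borel {g : UnitSquare → UnitSquare}
    (hg : LebesguePreserving g) :
    ∃ F : UnitSquare × UnitSquare → UnitSquare × UnitSquare,
      MeasurePreserving F volume volume ∧ Prod.map g g =ᵐ[volume] F := by
  have hae := hg.aemeasurable
  have hmp : MeasurePreserving (hae.mk g) (volume : Measure UnitSquare) volume := by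
    refine ⟨hae.measurable_mk, ?_⟩
    rw [← Measure.map_congr hae.ae_eq_mk, hg.map_eq]
  refine ⟨Prod.map (hae.mk g) (hae.mk g), hmp.prod hmp, ?_⟩
  have h1 : ∀ᵐ p : UnitSquare × UnitSquare ∂volume, g p.1 = hae.mk g p.1 :=
    Measure.quasiMeasurePreserving_fst.ae hae.ae_eq_mk
  have h2 : ∀ᵐ p : UnitSquare × UnitSquare ∂volume, g p.2 = hae.mk g p.2 :=
    Measure.quasiMeasurePreserving_snd.ae hae.ae_eq_mk
  filter_upwards [h1, h2] with p hp1 hp2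
  exact Prod.ext hp1 hp2

theorem LebesguePreserving.prod_aemeasurable {g : UnitSquare → UnitSquare}
    (hg : LebesguePreserving g) : AEMeasurable (Prod.map g g) volume := by
  obtain ⟨F, hF, hgF⟩ := hg.exists_borel
  exact ⟨F, hF.measurable, hgF⟩

theorem LebesguePreserving.prod_map_eq {g : UnitSquare → UnitSquare}
    (hg : LebesguePreserving g) : Measure.map (Prod.map g g) volume = volume := by
  obtain ⟨F, hF, hgF⟩ := hg.exists_borel
  rw [Measure.map_congr hgF, hF.map_eq]

namespace MPBijection

/-- The identity. -/
def refl : MPBijection where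
  toEquiv := Equiv.refl UnitSquare
  preserving := fun _ hX => ⟨hX, rfl⟩
  preserving_inv := fun _ hX => ⟨hX, rfl⟩

instance : Nonempty MPBijection := ⟨refl⟩

/-- The inverse bijection. -/
def symm (f : MPBijection) : MPBijection where
  toEquiv := f.toEquiv.symm
  preserving := f.preserving_inv
  preserving_inv := f.preserving

/-- The composition `g ∘ f`. -/
def trans (f g : MPBijection) : MPBijection where
  toEquiv := f.toEquiv.trans g.toEquiv
  preserving := fun X hX => by
    obtain ⟨h1, h2⟩ := g.preserving X hX
    obtain ⟨h3, h4⟩ := f.preserving _ h1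
    exact ⟨h3, h4.trans h2⟩
  preserving_inv := fun X hX => by
    obtain ⟨h1, h2⟩ := f.preserving_inv X hX
    obtain ⟨h3, h4⟩ := g.preserving_inv _ h1
    exact ⟨h3, h4.trans h2⟩

/-- `Shift(f) = sup_{(x,a)} |x - π₁(f(x,a))|`. -/
def shift (f : MPBijection) : ℝ :=
  ⨆ v : UnitSquare, |(v.1 : ℝ) - ((f.toFun v).1 : ℝ)|

end MPBijection

/-- The orderon `W^f`, given by `W^f(v, w) = W(f(v), f(w))`. -/
def Orderon.pullback (W : Orderon) (f : MPBijection) : Orderon where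
  toFun := fun p => W.toFun (f.toFun p.1, f.toFun p.2)
  measurable' := by
    have hW : AEMeasurable W.toFun (Measure.map (Prod.map f.toFun f.toFun) volume) := by
      rw [f.preserving.prod_map_eq]
      exact W.measurable'.aemeasurable
    exact (hW.comp_aemeasurable f.preserving.prod_aemeasurable).nullMeasurable
  symm' := fun _ _ => W.symm' _ _
  mem_Icc' := fun _ => W.mem_Icc' _

/-- The cut norm: the supremum of `|∫_{S × T} H|` over Lebesgue measurable `S, T ⊆ [0,1]²`
(a genuine supremum of a bounded set of reals whenever `H` is integrable). -/
def cutNorm (H : UnitSquare × UnitSquare → ℝ) : ℝ :=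
  ⨆ P : {S : Set UnitSquare // NullMeasurableSet S volume} ×
      {T : Set UnitSquare // NullMeasurableSet T volume},
    |∫ p in P.1.1 ×ˢ P.2.1, H p|

/-- The cut-shift distance `inf_f (Shift(f) + ‖W - U^f‖_□)`, over all measure preserving
bijections `f` of the unit square. -/
def cutShiftDist (W U : Orderon) : ℝ :=
  ⨅ f : MPBijection, (f.shift + cutNorm (fun p => W.toFun p - (U.pullback f).toFun p))

/-! The cut-shift distance is a pseudometric. -/

theorem MPBijection.shift_bddAbove (f : MPBijection) :
    BddAbove (Set.range fun v : UnitSquare => |(v.1 : ℝ) - ((f.toFun v).1 : ℝ)|) := by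
  refine ⟨1, ?_⟩
  rintro _ ⟨v, rfl⟩
  have h1 := v.1.2
  have h2 := (f.toFun v).1.2
  exact abs_le.2 ⟨by linarith [h1.1, h2.2], by linarith [h1.2, h2.1]⟩

theorem MPBijection.shift_nonneg (f : MPBijection) : 0 ≤ f.shift :=
  Real.iSup_nonneg fun _ => abs_nonneg _

theorem MPBijection.shift_symm_le (f : MPBijection) : f.symm.shift ≤ f.shift := by
  refine ciSup_le fun v => ?_
  have h := le_ciSup f.shift_bddAbove (f.symm.toFun v)
  have h2 : f.toFun (f.symm.toFun v) = v := f.right_inv v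
  simp only [h2] at h
  rw [abs_sub_comm]
  exact h

theorem MPBijection.shift_trans_le (f g : MPBijection) :
    (f.trans g).shift ≤ f.shift + g.shift := by
  refine ciSup_le fun v => ?_
  have h1 := le_ciSup f.shift_bddAbove v
  have h2 := le_ciSup g.shift_bddAbove (f.toFun v)
  exact (abs_sub_le _ ((f.toFun v).1 : ℝ) _).trans (add_le_add h1 h2)

theorem MPBijection.shift_refl : MPBijection.refl.shift = 0 := by
  have h : ∀ v : UnitSquare, |(v.1 : ℝ) - ((MPBijection.refl.toFun v).1 : ℝ)| = 0 := fun v => by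
    show |(v.1 : ℝ) - (v.1 : ℝ)| = 0
    simp
  unfold MPBijection.shift
  simp only [h, ciSup_const]

theorem Orderon.integrable (W : Orderon) : Integrable W.toFun volume := by
  refine Integrable.of_bound W.measurable'.aemeasurable.aestronglyMeasurable 1
    (Eventually.of_forall fun p => ?_)
  rw [Real.norm_eq_abs, abs_of_nonneg (W.mem_Icc' p).1]
  exact (W.mem_Icc' p).2

theorem cutNorm_nonneg (H : UnitSquare × UnitSquare → ℝ) : 0 ≤ cutNorm H :=
  Real.iSup_nonneg fun _ => abs_nonneg _

theorem abs_setIntegral_le_cutNorm {H : UnitSquare × UnitSquare → ℝ} (hH : Integrable H volume)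
    {S T : Set UnitSquare} (hS : NullMeasurableSet S volume) (hT : NullMeasurableSet T volume) :
    |∫ p in S ×ˢ T, H p| ≤ cutNorm H := by
  have hb : BddAbove (Set.range fun P : {S : Set UnitSquare // NullMeasurableSet S volume} ×
      {T : Set UnitSquare // NullMeasurableSet T volume} => |∫ p in P.1.1 ×ˢ P.2.1, H p|) := by
    refine ⟨∫ p, |H p|, ?_⟩
    rintro _ ⟨P, rfl⟩
    refine (abs_integral_le_integral_abs).trans ?_
    exact setIntegral_le_integral hH.abs (Eventually.of_forall fun _ => abs_nonneg _)
  exact le_ciSup hb (⟨S, hS⟩, ⟨T, hT⟩)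

theorem cutNorm_le {H : UnitSquare × UnitSquare → ℝ} {c : ℝ}
    (h : ∀ S T : Set UnitSquare, NullMeasurableSet S volume → NullMeasurableSet T volume →
      |∫ p in S ×ˢ T, H p| ≤ c) : cutNorm H ≤ c := by
  have : Nonempty {S : Set UnitSquare // NullMeasurableSet S volume} :=
    ⟨⟨∅, MeasurableSet.empty.nullMeasurableSet⟩⟩
  exact ciSup_le fun P => h _ _ P.1.2 P.2.2

theorem cutNorm_sub_comm (A B : UnitSquare × UnitSquare → ℝ) :
    cutNorm (fun p => A p - B p) = cutNorm (fun p => B p - A p) := by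
  unfold cutNorm
  refine iSup_congr fun P => ?_
  rw [← abs_neg, ← integral_neg]
  simp only [neg_sub]

theorem cutNorm_add_le {A B : UnitSquare × UnitSquare → ℝ} (hA : Integrable A volume)
    (hB : Integrable B volume) : cutNorm (fun p => A p + B p) ≤ cutNorm A + cutNorm B := by
  refine cutNorm_le fun S T hS hT => ?_
  rw [integral_add hA.integrableOn hB.integrableOn]
  exact (abs_add_le _ _).trans (add_le_add (abs_setIntegral_le_cutNorm hA hS hT)
    (abs_setIntegral_le_cutNorm hB hS hT))

theorem cutNorm_pullback_le {H : UnitSquare × UnitSquare → ℝ} (hH : Integrable H volume)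
    (f : MPBijection) : cutNorm (fun p => H (f.toFun p.1, f.toFun p.2)) ≤ cutNorm H := by
  refine cutNorm_le fun S T hS hT => ?_
  have hS' : NullMeasurableSet (f.invFun ⁻¹' S) volume := (f.preserving_inv S hS).1
  have hT' : NullMeasurableSet (f.invFun ⁻¹' T) volume := (f.preserving_inv T hT).1
  have hST : NullMeasurableSet (S ×ˢ T) (volume : Measure (UnitSquare × UnitSquare)) :=
    hS.prod hT
  have hST' : NullMeasurableSet ((f.invFun ⁻¹' S) ×ˢ (f.invFun ⁻¹' T))
      (volume : Measure (UnitSquare × UnitSquare)) := hS'.prod hT'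
  have key : ∫ p in S ×ˢ T, H (f.toFun p.1, f.toFun p.2)
      = ∫ p in (f.invFun ⁻¹' S) ×ˢ (f.invFun ⁻¹' T), H p := by
    rw [← integral_indicator₀ hST, ← integral_indicator₀ hST']
    conv_rhs => rw [← f.preserving.prod_map_eq]
    rw [integral_map f.preserving.prod_aemeasurable]
    · refine integral_congr_ae (Eventually.of_forall fun p => ?_)
      have h1 : f.invFun (f.toFun p.1) = p.1 := f.left_inv p.1
      have h2 : f.invFun (f.toFun p.2) = p.2 := f.left_inv p.2
      have h3 : (f.toFun p.1, f.toFun p.2) ∈ (f.invFun ⁻¹' S) ×ˢ (f.invFun ⁻¹' T) ↔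
          p ∈ S ×ˢ T := by
        rw [Set.mem_prod, Set.mem_prod, Set.mem_preimage, Set.mem_preimage, h1, h2]
      by_cases hp : p ∈ S ×ˢ T
      · exact (Set.indicator_of_mem hp _).trans (Set.indicator_of_mem (h3.2 hp) H).symm
      · exact (Set.indicator_of_notMem hp _).trans
          (Set.indicator_of_notMem (fun h => hp (h3.1 h)) H).symm
    · rw [f.preserving.prod_map_eq]
      exact hH.aestronglyMeasurable.indicator₀ hST'
  rw [key]
  exact abs_setIntegral_le_cutNorm hH hS' hT'

theorem cutShiftDist_le (W U : Orderon) (f : MPBijection) :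
    cutShiftDist W U ≤ f.shift + cutNorm (fun p => W.toFun p - (U.pullback f).toFun p) := by
  refine ciInf_le ⟨0, ?_⟩ f
  rintro _ ⟨g, rfl⟩
  exact add_nonneg g.shift_nonneg (cutNorm_nonneg _)

theorem cutShiftDist_nonneg (W U : Orderon) : 0 ≤ cutShiftDist W U :=
  Real.iInf_nonneg fun g => add_nonneg g.shift_nonneg (cutNorm_nonneg _)

theorem cutShiftDist_self (W : Orderon) : cutShiftDist W W = 0 := by
  refine le_antisymm ?_ (cutShiftDist_nonneg W W)
  refine (cutShiftDist_le W W MPBijection.refl).trans ?_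
  rw [MPBijection.shift_refl, zero_add]
  refine cutNorm_le fun S T _ _ => ?_
  have h : ∀ p, W.toFun p - (W.pullback MPBijection.refl).toFun p = 0 := fun p => sub_self _
  simp [h]

theorem cutShiftDist_comm_le (W U : Orderon) : cutShiftDist W U ≤ cutShiftDist U W := by
  refine le_ciInf fun g => ?_
  refine (cutShiftDist_le W U g.symm).trans (add_le_add g.shift_symm_le ?_)
  rw [cutNorm_sub_comm U.toFun]
  have h := cutNorm_pullback_le ((W.pullback g).integrable.sub U.integrable) g.symm
  refine le_trans (le_of_eq ?_) h
  congr 1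
  funext p
  have h1 : g.toFun (g.symm.toFun p.1) = p.1 := g.right_inv p.1
  have h2 : g.toFun (g.symm.toFun p.2) = p.2 := g.right_inv p.2
  simp only [Pi.sub_apply, Orderon.pullback, h1, h2]

theorem cutShiftDist_triangle (W Z U : Orderon) :
    cutShiftDist W U ≤ cutShiftDist W Z + cutShiftDist Z U := by
  refine le_ciInf_add_ciInf fun f g => ?_
  refine (cutShiftDist_le W U (f.trans g)).trans ?_
  have h1 := f.shift_trans_le g
  have h2 := cutNorm_add_le (W.integrable.sub (Z.pullback f).integrable)
    ((Z.pullback f).integrable.sub ((U.pullback g).pullback f).integrable)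
  have h3 := cutNorm_pullback_le (Z.integrable.sub (U.pullback g).integrable) f
  have h4 : cutNorm (fun p => W.toFun p - (U.pullback (f.trans g)).toFun p)
      ≤ cutNorm (fun p => W.toFun p - (Z.pullback f).toFun p)
        + cutNorm (fun p => Z.toFun p - (U.pullback g).toFun p) := by
    refine le_trans (le_of_eq ?_) (h2.trans (add_le_add le_rfl h3))
    congr 1
    funext p
    simp only [Pi.sub_apply, sub_add_sub_cancel]
    rfl
  linarith

/-- The space of orderons, with the cut-shift distance. -/
instance : PseudoMetricSpace Orderon where
  dist := cutShiftDist
  dist_self := cutShiftDist_self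
  dist_comm := fun W U => le_antisymm (cutShiftDist_comm_le W U) (cutShiftDist_comm_le U W)
  dist_triangle := cutShiftDist_triangle

/-! Ordered graphs. A simple ordered graph on `n` vertices is a `SimpleGraph (Fin n)`, with the
vertices ordered as in `Fin n`. -/

/-- `Q_n(x) = ⌈n x⌉` for `x > 0` and `Q_n(0) = 1`; it takes values in `{1, …, n}`. -/
def blockNumber (n : ℕ) (x : unitInterval) : ℕ :=
  if x = 0 then 1 else ⌈(n : ℝ) * (x : ℝ)⌉₊

theorem blockNumber_pos {n : ℕ} (hn : 0 < n) (x : unitInterval) : 1 ≤ blockNumber n x := by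
  unfold blockNumber
  split_ifs with h
  · exact le_rfl
  · have hx : (0 : ℝ) < x := unitInterval.pos_iff_ne_zero.2 h
    have hn' : (0 : ℝ) < n := Nat.cast_pos.2 hn
    exact Nat.one_le_iff_ne_zero.2 (Nat.ceil_pos.2 (mul_pos hn' hx)).ne'

theorem blockNumber_le {n : ℕ} (hn : 0 < n) (x : unitInterval) : blockNumber n x ≤ n := by
  unfold blockNumber
  split_ifs with h
  · exact hn
  · exact Nat.ceil_le.2 (mul_le_of_le_one_right (Nat.cast_nonneg n) x.2.2)

/-- The vertex `Q_n(x)`, where the vertices `1, …, n` are named `0, …, n - 1` in `Fin n`. -/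
def blockIndex {n : ℕ} (hn : 0 < n) (x : unitInterval) : Fin n :=
  ⟨blockNumber n x - 1, by have h1 := blockNumber_pos hn x; have h2 := blockNumber_le hn x; omega⟩

theorem measurable_blockIndex {n : ℕ} (hn : 0 < n) : Measurable (blockIndex hn) := by
  have h : Measurable (blockNumber n) := by
    unfold blockNumber
    refine Measurable.ite (measurableSet_singleton (0 : unitInterval)) measurable_const ?_
    exact Nat.measurable_ceil.comp (measurable_subtype_coe.const_mul (n : ℝ))
  refine measurable_to_countable' fun i => ?_
  have : blockIndex hn ⁻¹' {i} = blockNumber n ⁻¹' {m | m - 1 = (i : ℕ)} := by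
    ext x
    simp [blockIndex, Fin.ext_iff]
  rw [this]
  exact h (MeasurableSet.of_discrete)

open Classical in
/-- The orderon `W_G` of a simple ordered graph `G` on `n ≥ 1` vertices:
`W_G((x,a),(y,b)) = G(Q_n(x), Q_n(y))`. -/
def Orderon.ofGraph {n : ℕ} (hn : 0 < n) (G : SimpleGraph (Fin n)) : Orderon where
  toFun := fun p => if G.Adj (blockIndex hn p.1.1) (blockIndex hn p.2.1) then 1 else 0
  measurable' := by
    have h : Measurable fun p : UnitSquare × UnitSquare =>
        (blockIndex hn p.1.1, blockIndex hn p.2.1) :=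
      ((measurable_blockIndex hn).comp (measurable_fst.comp measurable_fst)).prodMk
        ((measurable_blockIndex hn).comp (measurable_fst.comp measurable_snd))
    have h2 : Measurable fun q : Fin n × Fin n => if G.Adj q.1 q.2 then (1 : ℝ) else 0 :=
      measurable_of_countable _
    exact (h2.comp h).nullMeasurable
  symm' := fun v w => by simp only [G.adj_comm]
  mem_Icc' := fun p => by split_ifs <;> simp

end

/-! ### Blocks of the unit interval -/

/-! A vertex `(x, a)` may be moved almost vertically at little cost, so the second coordinate can be
absorbed into the order. Approximate `W` in `L¹` by a symmetric step function on an `M × M` grid of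
the square, with `M` a multiple of `m` (`Orderon.exists_grid_approx`). Weak regularity
(`exists_weakly_regular_coloring`) colours the cells with `m * 4 ^ r` colours, each colour lying in
one of the `m` vertical strips of width `1 / m`, so that up to a cut norm error `δ` with `1 < r * δ
^ 2` the value depends on the colours alone.

Now sort the cells by colour and stretch each, of side `1 / M`, into a vertical slice of width `1 /
M ^ 2` and full height. Areas are kept, and no cell leaves its strip, so the shift is at most `1 /
m` (`shift_rearrange_le`). In the new position the block function depends on the first coordinates
only, through a monotone colouring of the interval. Such a colouring fails to be constant on at most
as many of the `L` equal blocks as there are colours (`volume_not_constant_on_block_le`), so with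
`L` large it may be taken constant on every block.

What remains is a symmetric `L × L` matrix of densities, realised by an explicit graph with `p ^ 2`
vertices per block. Joining `x, y` when `x₁ y₁ + x₂ + y₂` lies among the first residues makes
different columns uncorrelated as soon as their slopes differ, which gives cut norm error about `(2
/ p) ^ (1 / 2)` (`abs_sum_affine_le`).

`Orderon.exists_graph_cutShiftDist_le` adds up the errors. Taking `m`, `δ⁻¹` and `p ^ (1 / 2)` of
order `ε⁻¹`, and `r` of order `ε⁻²`, gives `2 ^ O(ε⁻²)` vertices. This is stronger than the exponent
`-3 + η(ε)`: the function `η` can vanish near `0`. -/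

theorem blockIndex_eq_iff {n : ℕ} (hn : 0 < n) {x : unitInterval} (hx : 0 < x) (i : Fin n) :
    blockIndex hn x = i ↔ ((i : ℕ) : ℝ) < n * (x : ℝ) ∧ (n : ℝ) * (x : ℝ) ≤ (i : ℕ) + 1 := by
  have h1 := blockNumber_pos hn x
  have h2 : blockIndex hn x = i ↔ blockNumber n x = (i : ℕ) + 1 := by
    simp only [blockIndex, Fin.ext_iff]
    omega
  rw [h2, blockNumber, if_neg hx.ne', Nat.ceil_eq_iff (by omega)]
  simp

theorem blockIndex_spec {n : ℕ} (hn : 0 < n) {x : unitInterval} (hx : 0 < x) :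
    ((blockIndex hn x : ℕ) : ℝ) < n * (x : ℝ) ∧ (n : ℝ) * (x : ℝ) ≤ (blockIndex hn x : ℕ) + 1 :=
  (blockIndex_eq_iff hn hx _).1 rfl

theorem blockIndex_mono {n : ℕ} (hn : 0 < n) {x y : unitInterval} (hx : 0 < x) (hxy : x ≤ y) :
    blockIndex hn x ≤ blockIndex hn y := by
  have h1 := blockIndex_spec hn hx
  have h2 := blockIndex_spec hn (hx.trans_le hxy)
  have h3 : (n : ℝ) * (x : ℝ) ≤ n * (y : ℝ) :=
    mul_le_mul_of_nonneg_left hxy (Nat.cast_nonneg n)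
  have h4 : ((blockIndex hn x : ℕ) : ℝ) < ((blockIndex hn y : ℕ) : ℝ) + 1 := by linarith
  have h5 : (blockIndex hn x : ℕ) < (blockIndex hn y : ℕ) + 1 := by exact_mod_cast h4
  exact Fin.le_def.2 (by omega)

/-- The point of the block `(i/n, (i+1)/n]` with relative position `x`. -/
noncomputable def blockPoint {n : ℕ} (i : Fin n) (x : unitInterval) : unitInterval :=
  ⟨((i : ℕ) + (x : ℝ)) / n, by
    have hi : ((i : ℕ) : ℝ) + 1 ≤ n := by exact_mod_cast i.2
    have hn : (0 : ℝ) < n := by have := i.2; exact_mod_cast (by omega : 0 < n)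
    have h0 := x.2.1
    have h1 := x.2.2
    exact ⟨by positivity, (div_le_one hn).2 (by linarith)⟩⟩

/-- The relative position of `x` in its block. -/
noncomputable def blockFrac {n : ℕ} (hn : 0 < n) (x : unitInterval) : unitInterval :=
  Set.projIcc 0 1 zero_le_one ((n : ℝ) * (x : ℝ) - (blockIndex hn x : ℕ))

theorem coe_blockPoint {n : ℕ} (i : Fin n) (x : unitInterval) :
    (blockPoint i x : ℝ) = ((i : ℕ) + (x : ℝ)) / n := rfl

theorem coe_blockFrac {n : ℕ} (hn : 0 < n) {x : unitInterval} (hx : 0 < x) :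
    (blockFrac hn x : ℝ) = (n : ℝ) * (x : ℝ) - (blockIndex hn x : ℕ) := by
  have h := blockIndex_spec hn hx
  rw [blockFrac, Set.projIcc_of_mem zero_le_one ⟨by linarith, by linarith⟩]

theorem blockFrac_pos {n : ℕ} (hn : 0 < n) {x : unitInterval} (hx : 0 < x) :
    0 < blockFrac hn x := by
  have h := blockIndex_spec hn hx
  have h2 : (0 : ℝ) < blockFrac hn x := by rw [coe_blockFrac hn hx]; linarith
  exact h2

theorem blockPoint_pos {n : ℕ} (i : Fin n) {x : unitInterval} (hx : 0 < x) :
    0 < blockPoint i x := by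
  have hn : (0 : ℝ) < n := by have := i.2; exact_mod_cast (by omega : 0 < n)
  have hx' : (0 : ℝ) < x := hx
  have h2 : (0 : ℝ) < blockPoint i x := by rw [coe_blockPoint]; positivity
  exact h2

theorem blockIndex_blockPoint {n : ℕ} (hn : 0 < n) (i : Fin n) {x : unitInterval} (hx : 0 < x) :
    blockIndex hn (blockPoint i x) = i := by
  have hn' : (0 : ℝ) < n := Nat.cast_pos.2 hn
  have hx' : (0 : ℝ) < x := hx
  have hx1 : (x : ℝ) ≤ 1 := x.2.2
  rw [blockIndex_eq_iff hn (blockPoint_pos i hx), coe_blockPoint, mul_div_cancel₀ _ hn'.ne']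
  exact ⟨by linarith, by linarith⟩

theorem blockFrac_blockPoint {n : ℕ} (hn : 0 < n) (i : Fin n) {x : unitInterval} (hx : 0 < x) :
    blockFrac hn (blockPoint i x) = x := by
  have hn' : (0 : ℝ) < n := Nat.cast_pos.2 hn
  apply Subtype.ext
  rw [coe_blockFrac hn (blockPoint_pos i hx), blockIndex_blockPoint hn i hx, coe_blockPoint,
    mul_div_cancel₀ _ hn'.ne']
  ring

theorem blockPoint_blockIndex {n : ℕ} (hn : 0 < n) {x : unitInterval} (hx : 0 < x) :
    blockPoint (blockIndex hn x) (blockFrac hn x) = x := by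
  have hn' : (0 : ℝ) < n := Nat.cast_pos.2 hn
  apply Subtype.ext
  rw [coe_blockPoint, coe_blockFrac hn hx]
  field_simp
  ring

theorem measurable_blockPoint {n : ℕ} :
    Measurable fun p : Fin n × unitInterval => blockPoint p.1 p.2 := by
  refine measurable_from_prod_countable_right fun i => ?_
  refine Measurable.subtype_mk ?_
  have h : Measurable fun x : unitInterval => (x : ℝ) := measurable_subtype_coe
  exact (h.const_add ((i : ℕ) : ℝ)).div_const (n : ℝ)

theorem measurable_blockFrac {n : ℕ} (hn : 0 < n) : Measurable (blockFrac hn) := by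
  have h : Measurable fun x : unitInterval => ((blockIndex hn x : ℕ) : ℝ) :=
    (measurable_of_countable fun i : Fin n => ((i : ℕ) : ℝ)).comp (measurable_blockIndex hn)
  exact continuous_projIcc.measurable.comp ((measurable_subtype_coe.const_mul _).sub h)

/-! ### Lebesgue measure as the average over blocks -/

theorem lintegral_Ioc_block {n : ℕ} (hn : 0 < n) (ψ : ℝ → ENNReal) (k : ℕ) :
    ∫⁻ x in Ioc ((k : ℝ) / n) (((k + 1 : ℕ) : ℝ) / n), ψ x
      = (n : ENNReal)⁻¹ * ∫⁻ x in Ioc (0 : ℝ) 1, ψ (((k : ℝ) + x) / n) := by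
  have hn' : (0 : ℝ) < n := Nat.cast_pos.2 hn
  have himg : (fun x : ℝ => ((k : ℝ) + x) / n) '' Ioc (0 : ℝ) 1
      = Ioc ((k : ℝ) / n) (((k + 1 : ℕ) : ℝ) / n) := by
    ext y
    constructor
    · rintro ⟨x, ⟨h0, h1⟩, rfl⟩
      refine ⟨by dsimp only; gcongr; linarith, ?_⟩
      push_cast
      gcongr
    · rintro ⟨h0, h1⟩
      rw [div_lt_iff₀ hn'] at h0
      rw [le_div_iff₀ hn'] at h1
      push_cast at h1
      exact ⟨y * n - k, ⟨by linarith, by linarith⟩, by field_simp; ring⟩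
  rw [← himg, lintegral_image_eq_lintegral_abs_deriv_mul (f' := fun _ => 1 / (n : ℝ))
    measurableSet_Ioc]
  · rw [lintegral_const_mul' _ _ ENNReal.ofReal_ne_top, abs_of_nonneg (by positivity), one_div,
      ENNReal.ofReal_inv_of_pos hn', ENNReal.ofReal_natCast]
  · intro x _
    exact (((hasDerivAt_id x).const_add (k : ℝ)).div_const (n : ℝ)).hasDerivWithinAt
  · intro x _ y _ h
    simpa [hn'.ne'] using (div_left_inj' hn'.ne').1 h

theorem lintegral_Ioc_zero_div {n : ℕ} (hn : 0 < n) (ψ : ℝ → ENNReal) (k : ℕ) :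
    ∫⁻ x in Ioc (0 : ℝ) ((k : ℝ) / n), ψ x
      = (n : ENNReal)⁻¹ * ∑ i ∈ Finset.range k, ∫⁻ x in Ioc (0 : ℝ) 1, ψ (((i : ℝ) + x) / n) := by
  have hn' : (0 : ℝ) < n := Nat.cast_pos.2 hn
  induction k with
  | zero => simp
  | succ k ih =>
    rw [Finset.sum_range_succ, mul_add, ← ih, ← lintegral_Ioc_block hn,
      ← lintegral_union measurableSet_Ioc (Ioc_disjoint_Ioc_of_le le_rfl),
      Ioc_union_Ioc_eq_Ioc (by positivity) (by gcongr; simp)]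

theorem lintegral_unitInterval_eq_Ioc (ψ : ℝ → ENNReal) :
    ∫⁻ x : unitInterval, ψ x = ∫⁻ x in Ioc (0 : ℝ) 1, ψ x := by
  rw [unitInterval.volume_def, lintegral_subtype_comap measurableSet_Icc ψ]
  exact setLIntegral_congr Ioc_ae_eq_Icc.symm

/-- Affine change of variables on each block. Composing with `projIcc` extends `φ` to the line,
where the intervals `(i/n, (i+1)/n]` can be glued; the change of variables is along an injective
affine map, so `φ` may be arbitrary. -/
theorem lintegral_eq_sum_blockPoint {n : ℕ} (hn : 0 < n) (φ : unitInterval → ENNReal) :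
    ∫⁻ x, φ x = (n : ENNReal)⁻¹ * ∑ i : Fin n, ∫⁻ x, φ (blockPoint i x) := by
  have hn' : (0 : ℝ) < n := Nat.cast_pos.2 hn
  have h1 : ∀ i : Fin n, ∫⁻ x, φ (blockPoint i x)
      = ∫⁻ x in Ioc (0 : ℝ) 1, φ (projIcc 0 1 zero_le_one (((i : ℕ) + x) / n)) := by
    intro i
    rw [← lintegral_unitInterval_eq_Ioc
      (fun x : ℝ => φ (projIcc 0 1 zero_le_one (((i : ℕ) + x) / n)))]
    refine lintegral_congr fun x => ?_
    rw [← coe_blockPoint, projIcc_val]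
  have h2 : ∫⁻ x, φ x = ∫⁻ x in Ioc (0 : ℝ) 1, φ (projIcc 0 1 zero_le_one x) := by
    rw [← lintegral_unitInterval_eq_Ioc (fun x : ℝ => φ (projIcc 0 1 zero_le_one x))]
    exact lintegral_congr fun x => by rw [projIcc_val]
  have h3 := lintegral_Ioc_zero_div hn (fun x => φ (projIcc 0 1 zero_le_one x)) n
  rw [div_self hn'.ne', Finset.sum_range] at h3
  rw [h2, h3]
  exact congrArg _ (Finset.sum_congr rfl fun i _ => (h1 i).symm)

theorem ae_pos_unitInterval : ∀ᵐ x : unitInterval, 0 < x := by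
  have h : ∀ᵐ x : unitInterval, x ≠ 0 := by
    rw [ae_iff]
    simp only [ne_eq, not_not, ofPred_eq_eq_singleton]
    exact measure_singleton 0
  filter_upwards [h] with x hx
  exact unitInterval.pos_iff_ne_zero.2 hx

theorem volume_blockIndex_preimage {n : ℕ} (hn : 0 < n) (i : Fin n) :
    volume (blockIndex hn ⁻¹' {i}) = (n : ENNReal)⁻¹ := by
  have hm : MeasurableSet (blockIndex hn ⁻¹' {i}) :=
    measurable_blockIndex hn (measurableSet_singleton i)
  rw [← lintegral_indicator_one hm, lintegral_eq_sum_blockPoint hn]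
  have h : ∀ j : Fin n, ∫⁻ x, (blockIndex hn ⁻¹' {i}).indicator (1 : unitInterval → ENNReal)
      (blockPoint j x) = if j = i then 1 else 0 := by
    intro j
    have : ∫⁻ x, (blockIndex hn ⁻¹' {i}).indicator (1 : unitInterval → ENNReal)
        (blockPoint j x) = ∫⁻ _ : unitInterval, if j = i then 1 else 0 := by
      refine lintegral_congr_ae ?_
      filter_upwards [ae_pos_unitInterval] with x hx
      have hj := blockIndex_blockPoint hn j hx
      by_cases hji : j = i
      · rw [if_pos hji, indicator_of_mem (by rw [mem_preimage, hj]; exact hji)]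
        rfl
      · rw [if_neg hji, indicator_of_notMem (by rw [mem_preimage, hj]; exact hji)]
    rw [this]
    simp
  simp [h]

/-! ### Rearranging the cells of a grid into vertical slices -/

/-- The map sending the cell `c` of the `M × M` grid affinely onto the vertical slice `σ c`; it is
the identity on the axes. -/
noncomputable def cellsToSlices {M : ℕ} (hM : 0 < M) (σ : Fin M × Fin M ≃ Fin (M * M))
    (v : UnitSquare) : UnitSquare :=
  if 0 < v.1 ∧ 0 < v.2 then
    (blockPoint (σ (blockIndex hM v.1, blockIndex hM v.2)) (blockFrac hM v.1), blockFrac hM v.2)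
  else v

/-- The inverse of `cellsToSlices`. -/
noncomputable def slicesToCells {M : ℕ} (hM : 0 < M) (σ : Fin M × Fin M ≃ Fin (M * M))
    (v : UnitSquare) : UnitSquare :=
  if 0 < v.1 ∧ 0 < v.2 then
    (blockPoint (σ.symm (blockIndex (Nat.mul_pos hM hM) v.1)).1
      (blockFrac (Nat.mul_pos hM hM) v.1),
     blockPoint (σ.symm (blockIndex (Nat.mul_pos hM hM) v.1)).2 v.2)
  else v

/-- The inverse identities hold everywhere, not merely almost everywhere, because the half-open
blocks partition the positive coordinates exactly and the axes are fixed pointwise. -/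
theorem slicesToCells_cellsToSlices {M : ℕ} (hM : 0 < M) (σ : Fin M × Fin M ≃ Fin (M * M))
    (v : UnitSquare) : slicesToCells hM σ (cellsToSlices hM σ v) = v := by
  by_cases hv : 0 < v.1 ∧ 0 < v.2
  · have h1 := blockFrac_pos hM hv.1
    have h2 := blockFrac_pos hM hv.2
    rw [cellsToSlices, if_pos hv, slicesToCells, if_pos ⟨blockPoint_pos _ h1, h2⟩]
    simp only [blockIndex_blockPoint _ _ h1, blockFrac_blockPoint _ _ h1, Equiv.symm_apply_apply,
      blockPoint_blockIndex hM hv.1, blockPoint_blockIndex hM hv.2]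
  · rw [cellsToSlices, if_neg hv, slicesToCells, if_neg hv]

theorem cellsToSlices_slicesToCells {M : ℕ} (hM : 0 < M) (σ : Fin M × Fin M ≃ Fin (M * M))
    (v : UnitSquare) : cellsToSlices hM σ (slicesToCells hM σ v) = v := by
  by_cases hv : 0 < v.1 ∧ 0 < v.2
  · have h1 := blockFrac_pos (Nat.mul_pos hM hM) hv.1
    rw [slicesToCells, if_pos hv, cellsToSlices,
      if_pos ⟨blockPoint_pos _ h1, blockPoint_pos _ hv.2⟩]
    simp only [blockIndex_blockPoint _ _ h1, blockFrac_blockPoint _ _ h1,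
      blockIndex_blockPoint _ _ hv.2, blockFrac_blockPoint _ _ hv.2, Prod.mk.eta,
      Equiv.apply_symm_apply, blockPoint_blockIndex _ hv.1]
  · rw [slicesToCells, if_neg hv, cellsToSlices, if_neg hv]

theorem measurableSet_pos_pos : MeasurableSet {v : UnitSquare | 0 < v.1 ∧ 0 < v.2} :=
  (measurable_fst measurableSet_Ioi).inter (measurable_snd measurableSet_Ioi)

theorem measurable_cellsToSlices {M : ℕ} (hM : 0 < M) (σ : Fin M × Fin M ≃ Fin (M * M)) :
    Measurable (cellsToSlices hM σ) := by
  refine Measurable.ite measurableSet_pos_pos ?_ measurable_id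
  have h1 : Measurable fun v : UnitSquare => σ (blockIndex hM v.1, blockIndex hM v.2) :=
    (measurable_of_countable σ).comp
      (((measurable_blockIndex hM).comp measurable_fst).prodMk
        ((measurable_blockIndex hM).comp measurable_snd))
  exact (measurable_blockPoint.comp (h1.prodMk ((measurable_blockFrac hM).comp
    measurable_fst))).prodMk ((measurable_blockFrac hM).comp measurable_snd)

theorem measurable_slicesToCells {M : ℕ} (hM : 0 < M) (σ : Fin M × Fin M ≃ Fin (M * M)) :
    Measurable (slicesToCells hM σ) := by
  refine Measurable.ite measurableSet_pos_pos ?_ measurable_id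
  have h1 : Measurable fun v : UnitSquare => σ.symm (blockIndex (Nat.mul_pos hM hM) v.1) :=
    (measurable_of_countable σ.symm).comp ((measurable_blockIndex _).comp measurable_fst)
  exact (measurable_blockPoint.comp ((measurable_fst.comp h1).prodMk
    ((measurable_blockFrac _).comp measurable_fst))).prodMk
    (measurable_blockPoint.comp ((measurable_snd.comp h1).prodMk measurable_snd))

theorem lintegral_unitSquare_eq_sum {M : ℕ} (hM : 0 < M) {φ : UnitSquare → ENNReal}
    (hφ : Measurable φ) :
    ∫⁻ v, φ v = (M : ENNReal)⁻¹ * ((M : ENNReal)⁻¹ * ∑ c : Fin M × Fin M,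
      ∫⁻ x, ∫⁻ y, φ (blockPoint c.1 x, blockPoint c.2 y)) := by
  rw [Measure.volume_eq_prod, lintegral_prod φ hφ.aemeasurable, lintegral_eq_sum_blockPoint hM]
  congr 1
  rw [Fintype.sum_prod_type, Finset.mul_sum]
  refine Finset.sum_congr rfl fun i _ => ?_
  rw [← lintegral_finsetSum, ← lintegral_const_mul]
  · exact lintegral_congr fun x => lintegral_eq_sum_blockPoint hM _
  · refine Finset.measurable_fun_sum _ fun j _ => ?_
    refine Measurable.lintegral_prod_right' (f := fun q : unitInterval × unitInterval =>
      φ (blockPoint i q.1, blockPoint j q.2)) ?_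
    exact hφ.comp (((measurable_blockPoint.comp measurable_prodMk_left).comp
      measurable_fst).prodMk ((measurable_blockPoint.comp measurable_prodMk_left).comp
      measurable_snd))
  · intro j _
    refine Measurable.lintegral_prod_right' (f := fun q : unitInterval × unitInterval =>
      φ (blockPoint i q.1, blockPoint j q.2)) ?_
    exact hφ.comp (((measurable_blockPoint.comp measurable_prodMk_left).comp
      measurable_fst).prodMk ((measurable_blockPoint.comp measurable_prodMk_left).comp
      measurable_snd))

/-- Cells and slices all have area `M⁻²`, and in relative coordinates the map from a slice to its
cell is the identity. Averaging the indicator of `X` over cells and that of its preimage over slices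
thus gives the same sum, reindexed by `σ`. -/
theorem measurePreserving_slicesToCells {M : ℕ} (hM : 0 < M)
    (σ : Fin M × Fin M ≃ Fin (M * M)) :
    MeasurePreserving (slicesToCells hM σ) volume volume := by
  have hmeas := measurable_slicesToCells hM σ
  refine ⟨hmeas, ?_⟩
  ext X hX
  rw [Measure.map_apply hmeas hX, ← lintegral_indicator_one (hmeas hX),
    ← lintegral_indicator_one hX,
    lintegral_unitSquare_eq_sum hM (measurable_one.indicator hX), Measure.volume_eq_prod,
    lintegral_prod _ (measurable_one.indicator (hmeas hX)).aemeasurable,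
    lintegral_eq_sum_blockPoint (Nat.mul_pos hM hM), ← mul_assoc, Nat.cast_mul,
    ENNReal.mul_inv (by simp) (by simp)]
  congr 1
  refine (Fintype.sum_equiv σ _ _ fun c => ?_).symm
  refine lintegral_congr_ae ?_
  filter_upwards [ae_pos_unitInterval] with x hx
  refine lintegral_congr_ae ?_
  filter_upwards [ae_pos_unitInterval] with y hy
  have h : slicesToCells hM σ (blockPoint (σ c) x, y) = (blockPoint c.1 x, blockPoint c.2 y) := by
    rw [slicesToCells, if_pos ⟨blockPoint_pos _ hx, hy⟩]
    simp only [blockIndex_blockPoint _ _ hx, blockFrac_blockPoint _ _ hx, Equiv.symm_apply_apply]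
  rw [← h]
  by_cases hmem : slicesToCells hM σ (blockPoint (σ c) x, y) ∈ X
  · rw [indicator_of_mem hmem, indicator_of_mem (mem_preimage.2 hmem)]
    rfl
  · rw [indicator_of_notMem hmem, indicator_of_notMem fun h' => hmem (mem_preimage.1 h')]

/-- `cellsToSlices` as a measurable equivalence. -/
noncomputable def rearrangeEquiv {M : ℕ} (hM : 0 < M) (σ : Fin M × Fin M ≃ Fin (M * M)) :
    UnitSquare ≃ᵐ UnitSquare where
  toFun := cellsToSlices hM σ
  invFun := slicesToCells hM σ
  left_inv := slicesToCells_cellsToSlices hM σ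
  right_inv := cellsToSlices_slicesToCells hM σ
  measurable_toFun := measurable_cellsToSlices hM σ
  measurable_invFun := measurable_slicesToCells hM σ

theorem MeasureTheory.MeasurePreserving.lebesguePreserving {g : UnitSquare → UnitSquare}
    (hg : MeasurePreserving g volume volume) : LebesguePreserving g := fun _ hX =>
  ⟨hX.preimage hg.quasiMeasurePreserving, hg.measure_preimage hX⟩

/-- `cellsToSlices` as a measure preserving bijection. -/
noncomputable def rearrange {M : ℕ} (hM : 0 < M) (σ : Fin M × Fin M ≃ Fin (M * M)) :
    MPBijection where
  toEquiv := (rearrangeEquiv hM σ).toEquiv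
  preserving := (MeasurePreserving.symm (rearrangeEquiv hM σ).symm
    (measurePreserving_slicesToCells hM σ)).lebesguePreserving
  preserving_inv := (measurePreserving_slicesToCells hM σ).lebesguePreserving

theorem rearrange_apply {M : ℕ} (hM : 0 < M) (σ : Fin M × Fin M ≃ Fin (M * M))
    (v : UnitSquare) : (rearrange hM σ).toFun v = cellsToSlices hM σ v := rfl

/-! ### Weak regularity for symmetric matrices -/

/-- A linear functional on a cube is maximal at a vertex: keep the positive coefficients. Applied in
each variable in turn, this passes from sets to fractional weights in the matrix cut norm. -/
theorem exists_sum_mul_le_sum {ι : Type*} [Fintype ι] (a s : ι → ℝ) (h0 : ∀ i, 0 ≤ s i)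
    (h1 : ∀ i, s i ≤ 1) : ∃ S : Finset ι, ∑ i, s i * a i ≤ ∑ i ∈ S, a i := by
  classical
  refine ⟨Finset.univ.filter fun i => 0 < a i, ?_⟩
  rw [Finset.sum_filter]
  refine Finset.sum_le_sum fun i _ => ?_
  split_ifs with h
  · exact mul_le_of_le_one_left h.le (h1 i)
  · exact mul_nonpos_of_nonneg_of_nonpos (h0 i) (not_lt.1 h)

theorem sum_weighted_le_of_forall_finset {ι : Type*} [Fintype ι] {h : ι → ι → ℝ} {C : ℝ}
    (hC : ∀ S T : Finset ι, ∑ i ∈ S, ∑ j ∈ T, h i j ≤ C) (s t : ι → ℝ)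
    (hs0 : ∀ i, 0 ≤ s i) (hs1 : ∀ i, s i ≤ 1) (ht0 : ∀ i, 0 ≤ t i) (ht1 : ∀ i, t i ≤ 1) :
    ∑ i, ∑ j, s i * t j * h i j ≤ C := by
  obtain ⟨S, hS⟩ := exists_sum_mul_le_sum (fun i => ∑ j, t j * h i j) s hs0 hs1
  obtain ⟨T, hT⟩ := exists_sum_mul_le_sum (fun j => ∑ i ∈ S, h i j) t ht0 ht1
  calc ∑ i, ∑ j, s i * t j * h i j = ∑ i, s i * ∑ j, t j * h i j := by
        simp only [Finset.mul_sum, mul_assoc]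
    _ ≤ ∑ i ∈ S, ∑ j, t j * h i j := hS
    _ = ∑ j, t j * ∑ i ∈ S, h i j := by
        rw [Finset.sum_comm]
        simp only [Finset.mul_sum]
    _ ≤ ∑ j ∈ T, ∑ i ∈ S, h i j := hT
    _ = ∑ i ∈ S, ∑ j ∈ T, h i j := Finset.sum_comm
    _ ≤ C := hC S T

theorem abs_sum_weighted_le_of_forall_finset {ι : Type*} [Fintype ι] {h : ι → ι → ℝ} {C : ℝ}
    (hC : ∀ S T : Finset ι, |∑ i ∈ S, ∑ j ∈ T, h i j| ≤ C) (s t : ι → ℝ)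
    (hs0 : ∀ i, 0 ≤ s i) (hs1 : ∀ i, s i ≤ 1) (ht0 : ∀ i, 0 ≤ t i) (ht1 : ∀ i, t i ≤ 1) :
    |∑ i, ∑ j, s i * t j * h i j| ≤ C := by
  have h1 := sum_weighted_le_of_forall_finset (fun S T => (le_abs_self _).trans (hC S T))
    s t hs0 hs1 ht0 ht1
  have h2 := sum_weighted_le_of_forall_finset (h := fun i j => -h i j) (C := C) (fun S T => by
    simp only [Finset.sum_neg_distrib]
    exact (neg_le_abs _).trans (hC S T)) s t hs0 hs1 ht0 ht1
  simp only [mul_neg, Finset.sum_neg_distrib] at h2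
  exact abs_le.2 ⟨by linarith, h1⟩

theorem sq_sub_clamp_le {a x : ℝ} (h0 : 0 ≤ a) (h1 : a ≤ 1) :
    (a - max 0 (min 1 x)) ^ 2 ≤ (a - x) ^ 2 := by
  rcases le_total x 0 with hx | hx
  · rw [max_eq_left ((min_le_right _ _).trans hx)]
    nlinarith
  · rcases le_total x 1 with hx' | hx'
    · rw [min_eq_right hx', max_eq_right hx]
    · rw [min_eq_left hx', max_eq_right zero_le_one]
      nlinarith

/-- Convexity of the square: since `w` is symmetric, `u` and its transpose are equally far from `w`,
and their mean is no farther. -/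
theorem sum_sq_sub_symmetrize_le {ι : Type*} [Fintype ι] {w : ι → ι → ℝ}
    (hw : ∀ i j, w i j = w j i) (u : ι → ι → ℝ) :
    ∑ i, ∑ j, (w i j - (u i j + u j i) / 2) ^ 2 ≤ ∑ i, ∑ j, (w i j - u i j) ^ 2 := by
  have h1 : ∑ i, ∑ j, (w i j - u j i) ^ 2 = ∑ i, ∑ j, (w i j - u i j) ^ 2 := by
    rw [Finset.sum_comm]
    exact Finset.sum_congr rfl fun i _ => Finset.sum_congr rfl fun j _ => by rw [hw j i]
  calc ∑ i, ∑ j, (w i j - (u i j + u j i) / 2) ^ 2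
      ≤ ∑ i, ∑ j, ((w i j - u i j) ^ 2 / 2 + (w i j - u j i) ^ 2 / 2) := by
        refine Finset.sum_le_sum fun i _ => Finset.sum_le_sum fun j _ => ?_
        nlinarith [sq_nonneg (u i j - u j i)]
    _ = ∑ i, ∑ j, (w i j - u i j) ^ 2 := by
        simp only [Finset.sum_add_distrib, ← Finset.sum_div, h1]
        ring

-- The energy decrement of weak regularity. With `N` the size of `ι`, `A` the sum over `S × T` and
-- `z = A / N ^ 2`, subtracting `z` on `S × T` changes the energy by `-2 z A + z ^ 2 |S| |T| ≤ -A ^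
-- 2 / N ^ 2`. Dividing by `N ^ 2` instead of `|S| |T|` is not optimal but suffices.
open Classical in
theorem sum_sq_sub_cut_le {ι : Type*} [Fintype ι] (h : ι → ι → ℝ) (S T : Finset ι) {δ : ℝ}
    (hδ : 0 ≤ δ) (hST : δ * (Fintype.card ι : ℝ) ^ 2 < |∑ i ∈ S, ∑ j ∈ T, h i j|) :
    ∑ i, ∑ j, (h i j - (∑ i ∈ S, ∑ j ∈ T, h i j) / (Fintype.card ι : ℝ) ^ 2
        * ((if i ∈ S then 1 else 0) * (if j ∈ T then 1 else 0))) ^ 2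
      ≤ ∑ i, ∑ j, h i j ^ 2 - δ ^ 2 * (Fintype.card ι : ℝ) ^ 2 := by
  set N : ℝ := (Fintype.card ι : ℝ) with hN
  set A : ℝ := ∑ i ∈ S, ∑ j ∈ T, h i j with hA
  set z : ℝ := A / N ^ 2 with hz
  have hN0 : 0 < N := by
    rcases (Nat.cast_nonneg (Fintype.card ι) : (0 : ℝ) ≤ _).eq_or_lt with h0 | h0
    · have : IsEmpty ι := Fintype.card_eq_zero_iff.1 (by exact_mod_cast h0.symm)
      have hA0 : A = 0 := Finset.sum_eq_zero fun i _ => (this.false i).elim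
      rw [hA0, abs_zero, hN, ← h0] at hST
      simp at hST
    · exact h0
  have hAz : A = z * N ^ 2 := by rw [hz]; field_simp
  have h1 : ∑ i, ∑ j, h i j * ((if i ∈ S then 1 else 0) * (if j ∈ T then 1 else 0)) = A := by
    have h6 : A = ∑ i, if i ∈ S then ∑ j, if j ∈ T then h i j else 0 else 0 := by
      simp [hA, Finset.sum_ite_mem]
    rw [h6]
    refine Finset.sum_congr rfl fun i _ => ?_
    by_cases hi : i ∈ S <;> simp [hi]
  have h2 : ∑ i : ι, ∑ j : ι, (((if i ∈ S then 1 else 0) * (if j ∈ T then 1 else 0) : ℝ)) ^ 2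
      ≤ N ^ 2 := by
    calc _ ≤ ∑ i : ι, ∑ j : ι, (1 : ℝ) := by
          refine Finset.sum_le_sum fun i _ => Finset.sum_le_sum fun j _ => ?_
          split_ifs <;> norm_num
      _ = N ^ 2 := by simp [hN, sq]
  have h3 : ∑ i, ∑ j, (h i j - z * ((if i ∈ S then 1 else 0) * (if j ∈ T then 1 else 0))) ^ 2
      = ∑ i, ∑ j, h i j ^ 2 - 2 * z * A + z ^ 2 *
        ∑ i : ι, ∑ j : ι, (((if i ∈ S then 1 else 0) * (if j ∈ T then 1 else 0) : ℝ)) ^ 2 := by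
    rw [← h1]
    simp only [Finset.mul_sum, ← Finset.sum_sub_distrib, ← Finset.sum_add_distrib]
    refine Finset.sum_congr rfl fun i _ => Finset.sum_congr rfl fun j _ => ?_
    ring
  have h4 : δ < |z| := by
    rw [hAz, abs_mul, abs_of_pos (pow_pos hN0 2)] at hST
    exact lt_of_mul_lt_mul_right hST (by positivity)
  have h5 : δ ^ 2 ≤ z ^ 2 := by
    rw [← sq_abs z]
    exact pow_le_pow_left₀ hδ h4.le 2
  rw [h3, hAz]
  nlinarith [mul_le_mul_of_nonneg_left h2 (sq_nonneg z),
    mul_le_mul_of_nonneg_right h5 (sq_nonneg N)]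

/-- Either the current block matrix is already good, or a violating pair `S, T` lowers the energy by
`δ ^ 2` per entry while each class splits into four according to membership in `S` and `T`. Values,
not conditional averages, are carried along, so no class needs to be nonempty. -/
theorem exists_coloring_step {ι K : Type} [Fintype ι] {w : ι → ι → ℝ}
    (hw : ∀ i j, w i j = w j i) (h0 : ∀ i j, 0 ≤ w i j) (h1 : ∀ i j, w i j ≤ 1)
    (κ₀ : ι → K) {δ : ℝ} (hδ : 0 ≤ δ) (r : ℕ) :
    ∃ (Q : Type) (_ : Fintype Q) (κ : ι → Q) (g : K × Q → K × Q → ℝ),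
      Fintype.card Q ≤ 4 ^ r ∧ (∀ a b, g a b = g b a) ∧ (∀ a b, 0 ≤ g a b) ∧
      (∀ a b, g a b ≤ 1) ∧
      ((∀ S T : Finset ι, |∑ i ∈ S, ∑ j ∈ T, (w i j - g (κ₀ i, κ i) (κ₀ j, κ j))|
          ≤ δ * (Fintype.card ι : ℝ) ^ 2) ∨
        ∑ i, ∑ j, (w i j - g (κ₀ i, κ i) (κ₀ j, κ j)) ^ 2
          ≤ (1 - r * δ ^ 2) * (Fintype.card ι : ℝ) ^ 2) := by
  classical
  induction r with
  | zero =>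
    refine ⟨Unit, inferInstance, fun _ => (), fun _ _ => 0, by simp, by simp, by simp, by simp,
      Or.inr ?_⟩
    calc _ ≤ ∑ i : ι, ∑ j : ι, (1 : ℝ) := by
          refine Finset.sum_le_sum fun i _ => Finset.sum_le_sum fun j _ => ?_
          have := h0 i j
          have := h1 i j
          nlinarith
      _ = _ := by simp [sq]
  | succ r ih =>
    obtain ⟨Q, _, κ, g, hQ, hg, hg0, hg1, hor⟩ := ih
    by_cases hgood : ∀ S T : Finset ι, |∑ i ∈ S, ∑ j ∈ T, (w i j - g (κ₀ i, κ i) (κ₀ j, κ j))|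
          ≤ δ * (Fintype.card ι : ℝ) ^ 2
    · exact ⟨Q, inferInstance, κ, g, hQ.trans (Nat.pow_le_pow_right (by norm_num) (by omega)),
        hg, hg0, hg1, Or.inl hgood⟩
    · have hle := hor.resolve_left hgood
      push Not at hgood
      obtain ⟨S, T, hST⟩ := hgood
      have hcut := sum_sq_sub_cut_le (fun i j => w i j - g (κ₀ i, κ i) (κ₀ j, κ j)) S T hδ hST
      set z : ℝ := (∑ i ∈ S, ∑ j ∈ T, (w i j - g (κ₀ i, κ i) (κ₀ j, κ j)))
        / (Fintype.card ι : ℝ) ^ 2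
      -- Membership in `S` is read from the first argument and in `T` from the second, so `g1` need
      -- not be symmetric or `[0, 1]`-valued; symmetrising and then clamping repairs both without
      -- raising the energy.
      let g1 : K × (Q × Bool × Bool) → K × (Q × Bool × Bool) → ℝ := fun a b =>
        g (a.1, a.2.1) (b.1, b.2.1)
          + z * ((if a.2.2.1 = true then 1 else 0) * (if b.2.2.2 = true then 1 else 0))
      let κ' : ι → Q × Bool × Bool := fun i => (κ i, decide (i ∈ S), decide (i ∈ T))
      refine ⟨Q × Bool × Bool, inferInstance, κ',
        fun a b => max 0 (min 1 ((g1 a b + g1 b a) / 2)), ?_, ?_, ?_, ?_, Or.inr ?_⟩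
      · simp only [Fintype.card_prod, Fintype.card_bool]
        rw [pow_succ]
        omega
      · intro a b
        dsimp only
        rw [add_comm]
      · exact fun a b => le_max_left _ _
      · exact fun a b => max_le zero_le_one (min_le_left _ _)
      · calc _ ≤ ∑ i, ∑ j, (w i j - (g1 (κ₀ i, κ' i) (κ₀ j, κ' j)
                + g1 (κ₀ j, κ' j) (κ₀ i, κ' i)) / 2) ^ 2 :=
              Finset.sum_le_sum fun i _ => Finset.sum_le_sum fun j _ =>
                sq_sub_clamp_le (h0 i j) (h1 i j)
          _ ≤ ∑ i, ∑ j, (w i j - g1 (κ₀ i, κ' i) (κ₀ j, κ' j)) ^ 2 :=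
              sum_sq_sub_symmetrize_le hw _
          _ = ∑ i, ∑ j, (w i j - g (κ₀ i, κ i) (κ₀ j, κ j)
                - z * ((if i ∈ S then 1 else 0) * (if j ∈ T then 1 else 0))) ^ 2 := by
              refine Finset.sum_congr rfl fun i _ => Finset.sum_congr rfl fun j _ => ?_
              simp only [g1, κ', decide_eq_true_eq]
              ring
          _ ≤ _ := hcut
          _ ≤ _ := by push_cast; linarith

/-- Weak regularity: a symmetric `[0, 1]`-valued matrix is close in cut norm to a symmetric
`[0, 1]`-valued block matrix, for a partition refining the given one `κ₀` into at most `4 ^ r`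
times as many parts. -/
theorem exists_weakly_regular_coloring {ι K : Type} [Fintype ι] [Nonempty ι] {w : ι → ι → ℝ}
    (hw : ∀ i j, w i j = w j i) (h0 : ∀ i j, 0 ≤ w i j) (h1 : ∀ i j, w i j ≤ 1)
    (κ₀ : ι → K) {δ : ℝ} (hδ : 0 ≤ δ) {r : ℕ} (hr : 1 < r * δ ^ 2) :
    ∃ (κ : ι → Fin (4 ^ r)) (g : K × Fin (4 ^ r) → K × Fin (4 ^ r) → ℝ),
      (∀ a b, g a b = g b a) ∧ (∀ a b, 0 ≤ g a b) ∧ (∀ a b, g a b ≤ 1) ∧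
      ∀ s t : ι → ℝ, (∀ i, 0 ≤ s i) → (∀ i, s i ≤ 1) → (∀ i, 0 ≤ t i) → (∀ i, t i ≤ 1) →
        |∑ i, ∑ j, s i * t j * (w i j - g (κ₀ i, κ i) (κ₀ j, κ j))|
          ≤ δ * (Fintype.card ι : ℝ) ^ 2 := by
  obtain ⟨Q, _, κ, g, hQ, hg, hg0, hg1, hor⟩ := exists_coloring_step hw h0 h1 κ₀ hδ r
  -- After `r` steps the energy would be at most `(1 - r * δ ^ 2) * N ^ 2 < 0`.
  have hgood := hor.resolve_right (fun h => by
    have hpos : 0 ≤ ∑ i, ∑ j, (w i j - g (κ₀ i, κ i) (κ₀ j, κ j)) ^ 2 :=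
      Finset.sum_nonneg fun i _ => Finset.sum_nonneg fun j _ => sq_nonneg _
    have hN : (0 : ℝ) < (Fintype.card ι : ℝ) ^ 2 := by
      have : 0 < Fintype.card ι := Fintype.card_pos
      positivity
    nlinarith [mul_pos (sub_pos.2 hr) hN])
  have : Nonempty Q := ⟨κ (Classical.arbitrary ι)⟩
  -- The palette is padded to exactly `4 ^ r` colours; on unused colours the left inverse `d` takes
  -- irrelevant values.
  obtain ⟨e, he⟩ : ∃ e : Q → Fin (4 ^ r), Function.Injective e := by
    obtain ⟨e⟩ := Function.Embedding.nonempty_of_card_le (α := Q) (β := Fin (4 ^ r)) (by simpa)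
    exact ⟨e, e.injective⟩
  let d : Fin (4 ^ r) → Q := Function.invFun e
  have hd : ∀ q, d (e q) = q := Function.leftInverse_invFun he
  refine ⟨fun i => e (κ i), fun a b => g (a.1, d a.2) (b.1, d b.2), fun a b => hg _ _,
    fun a b => hg0 _ _, fun a b => hg1 _ _, fun s t => ?_⟩
  simp only [hd]
  exact abs_sum_weighted_le_of_forall_finset hgood s t

/-! ### An explicit quasirandom graph with prescribed densities -/

section Quasirandom

variable {p : ℕ} [Fact p.Prime]

/-- Two affine forms with different slopes are jointly a bijection of the plane over `ZMod p`, so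
the sum factorises: this is pairwise independence. -/
theorem sum_mul_affine_eq_sq (φ : ZMod p → ℝ) {y y' : ZMod p × ZMod p} (h : y.1 ≠ y'.1) :
    ∑ x : ZMod p × ZMod p, φ (x.1 * y.1 + x.2 + y.2) * φ (x.1 * y'.1 + x.2 + y'.2)
      = (∑ z, φ z) ^ 2 := by
  have hinj : Function.Injective fun x : ZMod p × ZMod p =>
      (x.1 * y.1 + x.2 + y.2, x.1 * y'.1 + x.2 + y'.2) := by
    rintro ⟨a, b⟩ ⟨c, d⟩ hx
    simp only [Prod.mk.injEq] at hx
    obtain ⟨h1, h2⟩ := hx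
    have h3 : (a - c) * (y.1 - y'.1) = 0 := by linear_combination h1 - h2
    have h4 : a = c := by
      rcases mul_eq_zero.1 h3 with h | h'
      · exact sub_eq_zero.1 h
      · exact absurd (sub_eq_zero.1 h') h
    subst h4
    exact Prod.ext rfl (by linear_combination h1)
  have hbij := Finite.injective_iff_bijective.1 hinj
  rw [hbij.sum_comp (fun q : ZMod p × ZMod p => φ q.1 * φ q.2), Fintype.sum_prod_type, sq,
    Finset.sum_mul_sum]

/-- Second moment: expand the square into pairs `y, y'`. The `p ^ 3` pairs of equal slope contribute
at most `p ^ 2` each, and the others, fewer than `p ^ 4`, at most `1` each by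
`sum_mul_affine_eq_sq`. -/
theorem sum_sq_sum_affine_le {φ : ZMod p → ℝ} (hφ : ∀ z, |φ z| ≤ 1) (hsum : |∑ z, φ z| ≤ 1)
    {t : ZMod p × ZMod p → ℝ} (ht0 : ∀ y, 0 ≤ t y) (ht1 : ∀ y, t y ≤ 1) :
    ∑ x : ZMod p × ZMod p, (∑ y : ZMod p × ZMod p, t y * φ (x.1 * y.1 + x.2 + y.2)) ^ 2
      ≤ 2 * (p : ℝ) ^ 5 := by
  classical
  have hp1 : (1 : ℝ) ≤ p := by exact_mod_cast (Fact.out : p.Prime).one_lt.le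
  have h1 : ∑ x : ZMod p × ZMod p, (∑ y : ZMod p × ZMod p, t y * φ (x.1 * y.1 + x.2 + y.2)) ^ 2
      = ∑ y : ZMod p × ZMod p, ∑ y' : ZMod p × ZMod p, t y * t y' *
        ∑ x : ZMod p × ZMod p, φ (x.1 * y.1 + x.2 + y.2) * φ (x.1 * y'.1 + x.2 + y'.2) := by
    have h4 : ∀ x : ZMod p × ZMod p, (∑ y : ZMod p × ZMod p, t y * φ (x.1 * y.1 + x.2 + y.2)) ^ 2
        = ∑ y : ZMod p × ZMod p, ∑ y' : ZMod p × ZMod p, t y * t y' *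
          (φ (x.1 * y.1 + x.2 + y.2) * φ (x.1 * y'.1 + x.2 + y'.2)) := by
      intro x
      rw [sq, Finset.sum_mul_sum]
      exact Finset.sum_congr rfl fun y _ => Finset.sum_congr rfl fun y' _ => by ring
    rw [Finset.sum_congr rfl fun x _ => h4 x, Finset.sum_comm]
    refine Finset.sum_congr rfl fun y _ => ?_
    rw [Finset.sum_comm]
    exact Finset.sum_congr rfl fun y' _ => (Finset.mul_sum _ _ _).symm
  have h2 : ∀ y y' : ZMod p × ZMod p, t y * t y' *
      ∑ x : ZMod p × ZMod p, φ (x.1 * y.1 + x.2 + y.2) * φ (x.1 * y'.1 + x.2 + y'.2)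
      ≤ (if y.1 = y'.1 then (p : ℝ) ^ 2 else 0) + 1 := by
    intro y y'
    have htt0 : 0 ≤ t y * t y' := mul_nonneg (ht0 y) (ht0 y')
    have htt1 : t y * t y' ≤ 1 := mul_le_one₀ (ht1 y) (ht0 y') (ht1 y')
    by_cases h : y.1 = y'.1
    · rw [if_pos h]
      have h3 : ∑ x : ZMod p × ZMod p, φ (x.1 * y.1 + x.2 + y.2) * φ (x.1 * y'.1 + x.2 + y'.2)
          ≤ (p : ℝ) ^ 2 := by
        calc _ ≤ ∑ _x : ZMod p × ZMod p, (1 : ℝ) := by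
              refine Finset.sum_le_sum fun x _ => (le_abs_self _).trans ?_
              rw [abs_mul]
              exact mul_le_one₀ (hφ _) (abs_nonneg _) (hφ _)
          _ = (p : ℝ) ^ 2 := by simp [ZMod.card, sq]
      nlinarith [mul_le_mul_of_nonneg_left h3 htt0, sq_nonneg (p : ℝ)]
    · rw [if_neg h, sum_mul_affine_eq_sq φ h, zero_add]
      have h3 : (∑ z, φ z) ^ 2 ≤ 1 := by
        rw [← sq_abs]
        exact pow_le_one₀ (abs_nonneg _) hsum
      exact mul_le_one₀ htt1 (sq_nonneg _) h3
  have h3 : ∀ y : ZMod p × ZMod p,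
      ∑ y' : ZMod p × ZMod p, ((if y.1 = y'.1 then (p : ℝ) ^ 2 else 0) + 1)
        = (p : ℝ) ^ 3 + (p : ℝ) ^ 2 := by
    intro y
    rw [Finset.sum_add_distrib, Fintype.sum_prod_type]
    simp [ZMod.card, pow_succ, mul_assoc]
  rw [h1]
  calc _ ≤ ∑ y : ZMod p × ZMod p, ∑ y' : ZMod p × ZMod p,
          ((if y.1 = y'.1 then (p : ℝ) ^ 2 else 0) + 1) :=
        Finset.sum_le_sum fun y _ => Finset.sum_le_sum fun y' _ => h2 y y'
    _ = (p : ℝ) ^ 5 + (p : ℝ) ^ 4 := by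
        simp only [h3, Finset.sum_const, Finset.card_univ, Fintype.card_prod, ZMod.card,
          nsmul_eq_mul]
        push_cast
        ring
    _ ≤ 2 * (p : ℝ) ^ 5 := by
        have : (p : ℝ) ^ 4 ≤ (p : ℝ) ^ 5 := pow_le_pow_right₀ hp1 (by norm_num)
        linarith

/-- Cauchy–Schwarz in `x` against the second moment bound: the square is at most `p ^ 2 * (2 * p ^
5)`. -/
theorem abs_sum_affine_le {φ : ZMod p → ℝ} (hφ : ∀ z, |φ z| ≤ 1) (hsum : |∑ z, φ z| ≤ 1)
    {γ : ℝ} (hγ : 0 ≤ γ) (hγp : 2 ≤ γ ^ 2 * p)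
    {s t : ZMod p × ZMod p → ℝ} (hs0 : ∀ y, 0 ≤ s y) (hs1 : ∀ y, s y ≤ 1)
    (ht0 : ∀ y, 0 ≤ t y) (ht1 : ∀ y, t y ≤ 1) :
    |∑ x : ZMod p × ZMod p, ∑ y : ZMod p × ZMod p,
      s x * t y * φ (x.1 * y.1 + x.2 + y.2)| ≤ γ * (p : ℝ) ^ 4 := by
  have h1 : ∑ x : ZMod p × ZMod p, ∑ y : ZMod p × ZMod p,
      s x * t y * φ (x.1 * y.1 + x.2 + y.2)
      = ∑ x : ZMod p × ZMod p, s x * ∑ y : ZMod p × ZMod p,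
        t y * φ (x.1 * y.1 + x.2 + y.2) := by
    simp only [Finset.mul_sum, mul_assoc]
  have h2 : ∑ x : ZMod p × ZMod p, s x ^ 2 ≤ (p : ℝ) ^ 2 := by
    calc _ ≤ ∑ _x : ZMod p × ZMod p, (1 : ℝ) :=
          Finset.sum_le_sum fun x _ => pow_le_one₀ (hs0 x) (hs1 x)
      _ = (p : ℝ) ^ 2 := by simp [ZMod.card, sq]
  have h3 := sum_sq_sum_affine_le hφ hsum ht0 ht1
  refine abs_le_of_sq_le_sq ?_ (by positivity)
  rw [h1]
  calc _ ≤ (∑ x : ZMod p × ZMod p, s x ^ 2) * ∑ x : ZMod p × ZMod p,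
          (∑ y : ZMod p × ZMod p, t y * φ (x.1 * y.1 + x.2 + y.2)) ^ 2 :=
        Finset.sum_mul_sq_le_sq_mul_sq _ _ _
    _ ≤ (p : ℝ) ^ 2 * (2 * (p : ℝ) ^ 5) :=
        mul_le_mul h2 h3 (Finset.sum_nonneg fun x _ => sq_nonneg _) (by positivity)
    _ = 2 * (p : ℝ) ^ 7 := by ring
    _ ≤ (γ ^ 2 * p) * (p : ℝ) ^ 7 := by gcongr
    _ = (γ * (p : ℝ) ^ 4) ^ 2 := by ring

/-- Exactly `⌈p θ⌉` residues are below `p θ`; the rounding error is what keeps the centred indicator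
from having sum zero. -/
theorem abs_sum_indicator_sub_le {θ : ℝ} (h0 : 0 ≤ θ) (h1 : θ ≤ 1) :
    |∑ z : ZMod p, ((if (z.val : ℝ) < p * θ then 1 else 0) - θ)| ≤ 1 := by
  have hp : (0 : ℝ) < p := by exact_mod_cast (Fact.out : p.Prime).pos
  have h2 : ∑ z : ZMod p, (if (z.val : ℝ) < p * θ then (1 : ℝ) else 0)
      = ∑ i ∈ Finset.range p, if (i : ℝ) < p * θ then (1 : ℝ) else 0 := by
    refine Finset.sum_nbij ZMod.val ?_ ?_ ?_ ?_
    · exact fun z _ => Finset.mem_range.2 (ZMod.val_lt z)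
    · exact (ZMod.val_injective p).injOn
    · intro i hi
      exact ⟨(i : ZMod p), by simp, ZMod.val_cast_of_lt (Finset.mem_range.1 hi)⟩
    · exact fun z _ => rfl
  have h3 : (Finset.range p).filter (fun i : ℕ => (i : ℝ) < p * θ)
      = Finset.range ⌈(p : ℝ) * θ⌉₊ := by
    ext i
    rw [Finset.mem_filter, Finset.mem_range, Finset.mem_range, Nat.lt_ceil]
    refine ⟨fun h => h.2, fun h => ⟨?_, h⟩⟩
    have : (i : ℝ) < p := h.trans_le (mul_le_of_le_one_right hp.le h1)
    exact_mod_cast this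
  rw [Finset.sum_sub_distrib, h2, Finset.sum_boole, h3, Finset.card_range, Finset.sum_const,
    Finset.card_univ, ZMod.card, nsmul_eq_mul]
  have h4 := Nat.le_ceil ((p : ℝ) * θ)
  have h5 := Nat.ceil_lt_add_one (by positivity : 0 ≤ (p : ℝ) * θ)
  exact abs_le.2 ⟨by linarith, by linarith⟩

end Quasirandom

/-- The graph on `L` groups of `p²` vertices each, with density about `θ a b` between the groups
`a` and `b`. Within a pair of groups, `x, y : (ZMod p)²` are joined if the residue
`x₁ y₁ + x₂ + y₂` is small. -/
def quasirandomGraph {L p : ℕ} {θ : Fin L → Fin L → ℝ} (hθ : ∀ a b, θ a b = θ b a)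
    (e : Fin (p * p) ≃ ZMod p × ZMod p) : SimpleGraph (Fin (L * (p * p))) where
  Adj i j := i ≠ j ∧ ((((e i.modNat).1 * (e j.modNat).1 + (e i.modNat).2
    + (e j.modNat).2 : ZMod p).val : ℕ) : ℝ) < p * θ i.divNat j.divNat
  symm := ⟨fun i j h => by
    refine ⟨h.1.symm, ?_⟩
    rw [hθ, mul_comm (e j.modNat).1, add_right_comm]
    exact h.2⟩
  loopless := ⟨fun i h => h.1 rfl⟩

open Classical in
theorem abs_sum_quasirandomGraph_le {L p : ℕ} [Fact p.Prime] {θ : Fin L → Fin L → ℝ}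
    (hθ : ∀ a b, θ a b = θ b a) (h0 : ∀ a b, 0 ≤ θ a b) (h1 : ∀ a b, θ a b ≤ 1)
    (e : Fin (p * p) ≃ ZMod p × ZMod p) {γ : ℝ} (hγ : 0 ≤ γ) (hγp : 2 ≤ γ ^ 2 * p)
    {s t : Fin (L * (p * p)) → ℝ} (hs0 : ∀ i, 0 ≤ s i) (hs1 : ∀ i, s i ≤ 1)
    (ht0 : ∀ i, 0 ≤ t i) (ht1 : ∀ i, t i ≤ 1) :
    |∑ i, ∑ j, s i * t j * ((if (quasirandomGraph hθ e).Adj i j then 1 else 0)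
        - θ i.divNat j.divNat)|
      ≤ γ * ((L * (p * p) : ℕ) : ℝ) ^ 2 + ((L * (p * p) : ℕ) : ℝ) := by
  let E : Fin L × (ZMod p × ZMod p) ≃ Fin (L * (p * p)) :=
    (Equiv.prodCongr (Equiv.refl _) e.symm).trans finProdFinEquiv
  have hE1 : ∀ a x, (E (a, x)).divNat = a := fun a x =>
    congrArg Prod.fst (finProdFinEquiv.symm_apply_apply (a, e.symm x))
  have hE2 : ∀ a x, e (E (a, x)).modNat = x := fun a x => by
    have h : (E (a, x)).modNat = e.symm x :=
      congrArg Prod.snd (finProdFinEquiv.symm_apply_apply (a, e.symm x))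
    rw [h, Equiv.apply_symm_apply]
  let B : Fin (L * (p * p)) → Fin (L * (p * p)) → ℝ := fun i j =>
    (if ((((e i.modNat).1 * (e j.modNat).1 + (e i.modNat).2
      + (e j.modNat).2 : ZMod p).val : ℕ) : ℝ) < p * θ i.divNat j.divNat then 1 else 0)
      - θ i.divNat j.divNat
  have hB : |∑ i, ∑ j, s i * t j * B i j| ≤ γ * ((L * (p * p) : ℕ) : ℝ) ^ 2 := by
    have hblock : ∀ a b : Fin L, |∑ x : ZMod p × ZMod p, ∑ y : ZMod p × ZMod p,
        s (E (a, x)) * t (E (b, y)) * B (E (a, x)) (E (b, y))| ≤ γ * (p : ℝ) ^ 4 := by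
      intro a b
      simp only [B, hE1, hE2]
      refine abs_sum_affine_le
        (φ := fun z : ZMod p => (if (z.val : ℝ) < p * θ a b then 1 else 0) - θ a b)
        (fun z => ?_) (abs_sum_indicator_sub_le (h0 a b) (h1 a b)) hγ hγp
        (fun _ => hs0 _) (fun _ => hs1 _) (fun _ => ht0 _) (fun _ => ht1 _)
      have := h0 a b
      have := h1 a b
      split_ifs
      · exact abs_le.2 ⟨by linarith, by linarith⟩
      · exact abs_le.2 ⟨by linarith, by linarith⟩
    have hsum : ∑ i, ∑ j, s i * t j * B i j = ∑ a : Fin L, ∑ b : Fin L,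
        ∑ x : ZMod p × ZMod p, ∑ y : ZMod p × ZMod p,
          s (E (a, x)) * t (E (b, y)) * B (E (a, x)) (E (b, y)) := by
      rw [← E.sum_comp (fun i => ∑ j, s i * t j * B i j), Fintype.sum_prod_type]
      refine Finset.sum_congr rfl fun a _ => ?_
      refine (Finset.sum_congr rfl fun x _ => ?_).trans Finset.sum_comm
      rw [← E.sum_comp (fun j => s (E (a, x)) * t j * B (E (a, x)) j), Fintype.sum_prod_type]
    rw [hsum]
    calc _ ≤ ∑ a : Fin L, ∑ b : Fin L, γ * (p : ℝ) ^ 4 :=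
          (Finset.abs_sum_le_sum_abs _ _).trans (Finset.sum_le_sum fun a _ =>
            (Finset.abs_sum_le_sum_abs _ _).trans (Finset.sum_le_sum fun b _ => hblock a b))
      _ = γ * ((L * (p * p) : ℕ) : ℝ) ^ 2 := by
          simp only [Finset.sum_const, Finset.card_univ, Fintype.card_fin, nsmul_eq_mul]
          push_cast
          ring
  -- `B` ignores the ban on loops. It differs from the graph on the diagonal only, which costs at
  -- most one per vertex.
  have hdiff : |∑ i, ∑ j, s i * t j * ((if (quasirandomGraph hθ e).Adj i j then 1 else 0)
        - θ i.divNat j.divNat) - ∑ i, ∑ j, s i * t j * B i j|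
      ≤ ((L * (p * p) : ℕ) : ℝ) := by
    have hind : ∀ P Q : Prop, |(if P then (1 : ℝ) else 0) - (if Q then 1 else 0)| ≤ 1 := by
      intro P Q
      by_cases hP : P <;> by_cases hQ : Q <;> simp [hP, hQ]
    simp only [← Finset.sum_sub_distrib]
    calc _ ≤ ∑ i : Fin (L * (p * p)), ∑ j : Fin (L * (p * p)), if i = j then (1 : ℝ) else 0 := by
          refine (Finset.abs_sum_le_sum_abs _ _).trans (Finset.sum_le_sum fun i _ =>
            (Finset.abs_sum_le_sum_abs _ _).trans (Finset.sum_le_sum fun j _ => ?_))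
          rw [← mul_sub, abs_mul, abs_of_nonneg (mul_nonneg (hs0 i) (ht0 j))]
          have hst : s i * t j ≤ 1 := mul_le_one₀ (hs1 i) (ht0 j) (ht1 j)
          by_cases hij : i = j
          · rw [if_pos hij]
            refine mul_le_one₀ hst (abs_nonneg _) ?_
            rw [sub_sub_sub_cancel_right]
            exact hind _ _
          · simp [B, quasirandomGraph, hij]
      _ = _ := by simp
  have := abs_sub_abs_le_abs_sub (∑ i, ∑ j, s i * t j *
    ((if (quasirandomGraph hθ e).Adj i j then 1 else 0) - θ i.divNat j.divNat))
    (∑ i, ∑ j, s i * t j * B i j)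
  linarith

/-! ### Step functions and the cut norm -/

theorem cutNorm_le_integral_abs {H : UnitSquare × UnitSquare → ℝ} (hH : Integrable H volume) :
    cutNorm H ≤ ∫ p, |H p| := by
  refine cutNorm_le fun S T _ _ => abs_integral_le_integral_abs.trans ?_
  exact setIntegral_le_integral hH.abs (Eventually.of_forall fun _ => abs_nonneg _)

theorem cutNorm_sub_triangle {A B C : UnitSquare × UnitSquare → ℝ} (hA : Integrable A volume)
    (hB : Integrable B volume) (hC : Integrable C volume) :
    cutNorm (fun p => A p - C p)
      ≤ cutNorm (fun p => A p - B p) + cutNorm (fun p => B p - C p) := by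
  refine le_trans (le_of_eq ?_) (cutNorm_add_le (hA.sub hB) (hB.sub hC))
  simp only [sub_add_sub_cancel]

section Step

variable {ι : Type*} [Fintype ι] [MeasurableSpace ι] [MeasurableSingletonClass ι]
  {α : UnitSquare → ι}

theorem measurable_step (hα : Measurable α) (h : ι → ι → ℝ) :
    Measurable fun p : UnitSquare × UnitSquare => h (α p.1) (α p.2) :=
  (measurable_of_countable fun q : ι × ι => h q.1 q.2).comp
    ((hα.comp measurable_fst).prodMk (hα.comp measurable_snd))

theorem integrable_step (hα : Measurable α) (h : ι → ι → ℝ) :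
    Integrable (fun p : UnitSquare × UnitSquare => h (α p.1) (α p.2)) volume := by
  refine Integrable.of_bound (measurable_step hα h).aestronglyMeasurable (∑ i, ∑ j, |h i j|)
    (Eventually.of_forall fun p => ?_)
  rw [Real.norm_eq_abs]
  calc |h (α p.1) (α p.2)| ≤ ∑ j, |h (α p.1) j| :=
        Finset.single_le_sum (f := fun j => |h (α p.1) j|) (fun _ _ => abs_nonneg _)
          (Finset.mem_univ _)
    _ ≤ _ := Finset.single_le_sum (f := fun i => ∑ j, |h i j|)
        (fun _ _ => Finset.sum_nonneg fun _ _ => abs_nonneg _) (Finset.mem_univ _)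

theorem setIntegral_step (hα : Measurable α) (h : ι → ι → ℝ) {S T : Set UnitSquare} :
    ∫ p in S ×ˢ T, h (α p.1) (α p.2)
      = ∑ i, ∑ j, volume.real (S ∩ α ⁻¹' {i}) * volume.real (T ∩ α ⁻¹' {j}) * h i j := by
  classical
  have hset : ∀ i j, MeasurableSet ((α ⁻¹' {i}) ×ˢ (α ⁻¹' {j})) := fun i j =>
    (hα (measurableSet_singleton i)).prod (hα (measurableSet_singleton j))
  have h1 : ∀ p : UnitSquare × UnitSquare, h (α p.1) (α p.2)
      = ∑ i, ∑ j, ((α ⁻¹' {i}) ×ˢ (α ⁻¹' {j})).indicator (fun _ => h i j) p := by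
    intro p
    rw [Finset.sum_eq_single (α p.1), Finset.sum_eq_single (α p.2)]
    · rw [indicator_of_mem]
      exact ⟨rfl, rfl⟩
    · intro j _ hj
      exact indicator_of_notMem (fun hp => hj hp.2.symm) _
    · exact fun hj => absurd (Finset.mem_univ _) hj
    · intro i _ hi
      exact Finset.sum_eq_zero fun j _ => indicator_of_notMem (fun hp => hi hp.1.symm) _
    · exact fun hi => absurd (Finset.mem_univ _) hi
  simp only [h1]
  have hint : ∀ i j, Integrable (((α ⁻¹' {i}) ×ˢ (α ⁻¹' {j})).indicator fun _ => h i j)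
      ((volume : Measure (UnitSquare × UnitSquare)).restrict (S ×ˢ T)) := fun i j =>
    (integrable_const _).indicator (hset i j)
  rw [integral_finsetSum _ fun i _ => integrable_finsetSum _ fun j _ => hint i j]
  refine Finset.sum_congr rfl fun i _ => ?_
  rw [integral_finsetSum _ fun j _ => hint i j]
  refine Finset.sum_congr rfl fun j _ => ?_
  rw [setIntegral_indicator (hset i j), setIntegral_const, prod_inter_prod, smul_eq_mul,
    Measure.volume_eq_prod, measureReal_prod_prod]

/-- The integral over `S × T` sees only the measures of `S` and `T` inside each class. Multiplied by
`N` these become weights in `[0, 1]`, which is why the matrix bounds are stated for weights and not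
for sets. -/
theorem cutNorm_step_le (hα : Measurable α) {N : ℝ} (hN : 0 < N)
    (hvol : ∀ i, volume.real (α ⁻¹' {i}) ≤ N⁻¹) {h : ι → ι → ℝ} {C : ℝ}
    (hC : ∀ s t : ι → ℝ, (∀ i, 0 ≤ s i) → (∀ i, s i ≤ 1) → (∀ i, 0 ≤ t i) → (∀ i, t i ≤ 1) →
      |∑ i, ∑ j, s i * t j * h i j| ≤ C * N ^ 2) :
    cutNorm (fun p => h (α p.1) (α p.2)) ≤ C := by
  refine cutNorm_le fun S T _ _ => ?_
  have hle : ∀ (S : Set UnitSquare) i, N * volume.real (S ∩ α ⁻¹' {i}) ≤ 1 := fun S i => by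
    calc N * volume.real (S ∩ α ⁻¹' {i}) ≤ N * N⁻¹ :=
          mul_le_mul_of_nonneg_left ((measureReal_mono inter_subset_right).trans (hvol i)) hN.le
      _ = 1 := mul_inv_cancel₀ hN.ne'
  have h1 := hC (fun i => N * volume.real (S ∩ α ⁻¹' {i})) (fun i => N * volume.real (T ∩ α ⁻¹' {i}))
    (fun i => by positivity) (hle S) (fun i => by positivity) (hle T)
  have h2 : ∑ i, ∑ j, N * volume.real (S ∩ α ⁻¹' {i}) * (N * volume.real (T ∩ α ⁻¹' {j})) * h i j
      = (∫ p in S ×ˢ T, h (α p.1) (α p.2)) * N ^ 2 := by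
    rw [setIntegral_step hα, Finset.sum_mul]
    refine Finset.sum_congr rfl fun i _ => ?_
    rw [Finset.sum_mul]
    exact Finset.sum_congr rfl fun j _ => by ring
  rw [h2, abs_mul, abs_of_pos (pow_pos hN 2)] at h1
  exact le_of_mul_le_mul_right h1 (by positivity)

end Step

/-! ### Approximation by grid step functions -/

/-- The cell of the `M × M` grid that contains `v`. -/
noncomputable def gridCell {M : ℕ} (hM : 0 < M) (v : UnitSquare) : Fin M × Fin M :=
  (blockIndex hM v.1, blockIndex hM v.2)

theorem measurable_gridCell {M : ℕ} (hM : 0 < M) : Measurable (gridCell hM) :=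
  ((measurable_blockIndex hM).comp measurable_fst).prodMk
    ((measurable_blockIndex hM).comp measurable_snd)

theorem volume_gridCell_preimage {M : ℕ} (hM : 0 < M) (c : Fin M × Fin M) :
    volume.real (gridCell hM ⁻¹' {c}) = ((M : ℝ) ^ 2)⁻¹ := by
  have h : gridCell hM ⁻¹' {c} = (blockIndex hM ⁻¹' {c.1}) ×ˢ (blockIndex hM ⁻¹' {c.2}) := by
    ext v
    simp [gridCell, Prod.ext_iff]
  rw [h, Measure.volume_eq_prod, measureReal_prod_prod, measureReal_def, measureReal_def,
    volume_blockIndex_preimage, volume_blockIndex_preimage, ENNReal.toReal_inv,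
    ENNReal.toReal_natCast, sq, mul_inv]

theorem ae_pos_unitSquare : ∀ᵐ v : UnitSquare, 0 < v.1 ∧ 0 < v.2 := by
  have h1 : ∀ᵐ v : UnitSquare, 0 < v.1 :=
    Measure.quasiMeasurePreserving_fst.ae ae_pos_unitInterval
  have h2 : ∀ᵐ v : UnitSquare, 0 < v.2 :=
    Measure.quasiMeasurePreserving_snd.ae ae_pos_unitInterval
  exact h1.and h2

theorem ae_pos_unitSquare_prod : ∀ᵐ p : UnitSquare × UnitSquare,
    (0 < p.1.1 ∧ 0 < p.1.2) ∧ (0 < p.2.1 ∧ 0 < p.2.2) := by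
  have h1 : ∀ᵐ p : UnitSquare × UnitSquare, 0 < p.1.1 ∧ 0 < p.1.2 :=
    Measure.quasiMeasurePreserving_fst.ae ae_pos_unitSquare
  have h2 : ∀ᵐ p : UnitSquare × UnitSquare, 0 < p.2.1 ∧ 0 < p.2.2 :=
    Measure.quasiMeasurePreserving_snd.ae ae_pos_unitSquare
  exact h1.and h2

theorem dist_blockPoint_blockIndex_one_lt {M : ℕ} (hM : 0 < M) {x : unitInterval} (hx : 0 < x) :
    dist x (blockPoint (blockIndex hM x) 1) < (M : ℝ)⁻¹ := by
  have hM' : (0 : ℝ) < M := Nat.cast_pos.2 hM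
  obtain ⟨h1, h2⟩ := blockIndex_spec hM hx
  rw [Subtype.dist_eq, Real.dist_eq, coe_blockPoint, Icc.coe_one, abs_sub_comm,
    abs_of_nonneg (sub_nonneg.2 ((le_div_iff₀ hM').2 (by linarith))), sub_lt_iff_lt_add,
    div_lt_iff₀ hM', add_mul, inv_mul_cancel₀ hM'.ne']
  linarith

theorem abs_sub_clamp_le {a x : ℝ} (h0 : 0 ≤ a) (h1 : a ≤ 1) :
    |a - max 0 (min 1 x)| ≤ |a - x| :=
  sq_le_sq.1 (sq_sub_clamp_le h0 h1)

theorem Orderon.integral_swap_abs_sub (W : Orderon) {g : UnitSquare × UnitSquare → ℝ} :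
    ∫ p, |W.toFun p - g p.swap| = ∫ p, |W.toFun p - g p| := by
  rw [Measure.volume_eq_prod, ← integral_prod_swap]
  refine integral_congr_ae (Eventually.of_forall fun p => ?_)
  simp only [Prod.swap_swap]
  rw [Prod.swap, W.symm']

/-- Every orderon is close in `L¹` to a symmetric step function on every fine enough grid. -/
theorem Orderon.exists_grid_approx (W : Orderon) {δ : ℝ} (hδ : 0 < δ) :
    ∃ M₀ : ℕ, ∀ (M : ℕ) (hM : 0 < M), M₀ ≤ M →
      ∃ w : Fin M × Fin M → Fin M × Fin M → ℝ,
        (∀ c d, w c d = w d c) ∧ (∀ c d, 0 ≤ w c d) ∧ (∀ c d, w c d ≤ 1) ∧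
        ∫ p, |W.toFun p - w (gridCell hM p.1) (gridCell hM p.2)| ≤ δ := by
  obtain ⟨g, hg, hgi⟩ := W.integrable.exists_boundedContinuous_integral_sub_le (half_pos hδ)
  obtain ⟨ρ, hρ, huc⟩ := Metric.uniformContinuous_iff.1
    (CompactSpace.uniformContinuous_of_continuous g.continuous) (δ / 2) (half_pos hδ)
  obtain ⟨M₀, hM₀⟩ := exists_nat_gt ρ⁻¹
  refine ⟨M₀, fun M hM hMM => ?_⟩
  have hMρ : (M : ℝ)⁻¹ < ρ :=
    inv_lt_of_inv_lt₀ hρ (hM₀.trans_le (by exact_mod_cast hMM))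
  -- The continuous approximant `g` is sampled at the upper right corner of each cell. It need not
  -- be symmetric or `[0, 1]`-valued, hence the mean with its transpose and the clamp in `w`.
  let rep : Fin M × Fin M → UnitSquare := fun c => (blockPoint c.1 1, blockPoint c.2 1)
  let w : Fin M × Fin M → Fin M × Fin M → ℝ := fun c d =>
    max 0 (min 1 ((g (rep c, rep d) + g (rep d, rep c)) / 2))
  refine ⟨w, fun c d => by simp only [w, add_comm], fun c d => le_max_left _ _,
    fun c d => max_le zero_le_one (min_le_left _ _), ?_⟩
  have hrep : ∀ v : UnitSquare, 0 < v.1 ∧ 0 < v.2 → dist v (rep (gridCell hM v)) < ρ :=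
    fun v hv => max_lt ((dist_blockPoint_blockIndex_one_lt hM hv.1).trans hMρ)
      ((dist_blockPoint_blockIndex_one_lt hM hv.2).trans hMρ)
  have hgs : Integrable (fun p : UnitSquare × UnitSquare => g p.swap) volume := hgi.swap
  have hi1 : Integrable (fun p => |W.toFun p - g p|) volume := (W.integrable.sub hgi).abs
  have hi2 : Integrable (fun p => |W.toFun p - g p.swap|) volume := (W.integrable.sub hgs).abs
  have hi3 : Integrable (fun p => |W.toFun p - w (gridCell hM p.1) (gridCell hM p.2)|) volume :=
    (W.integrable.sub (integrable_step (measurable_gridCell hM) w)).abs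
  calc ∫ p, |W.toFun p - w (gridCell hM p.1) (gridCell hM p.2)|
      ≤ ∫ p, (|W.toFun p - g p| / 2 + |W.toFun p - g p.swap| / 2 + δ / 2) := by
        refine integral_mono_ae hi3 (((hi1.div_const 2).add (hi2.div_const 2)).add
          (integrable_const _)) ?_
        filter_upwards [ae_pos_unitSquare_prod] with p hp
        have hd1 : |g p - g (rep (gridCell hM p.1), rep (gridCell hM p.2))| < δ / 2 :=
          huc (max_lt (hrep p.1 hp.1) (hrep p.2 hp.2))
        have hd2 : |g p.swap - g (rep (gridCell hM p.2), rep (gridCell hM p.1))| < δ / 2 :=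
          huc (max_lt (hrep p.2 hp.2) (hrep p.1 hp.1))
        have hc := abs_sub_clamp_le (W.mem_Icc' p).1 (W.mem_Icc' p).2
          (x := (g (rep (gridCell hM p.1), rep (gridCell hM p.2))
            + g (rep (gridCell hM p.2), rep (gridCell hM p.1))) / 2)
        refine hc.trans ?_
        have e1 := abs_lt.1 hd1
        have e2 := abs_lt.1 hd2
        have e3 := abs_le.1 (le_refl |W.toFun p - g p|)
        have e4 := abs_le.1 (le_refl |W.toFun p - g p.swap|)
        exact abs_le.2 ⟨by linarith, by linarith⟩
    _ = (∫ p, |W.toFun p - g p|) / 2 + (∫ p, |W.toFun p - g p.swap|) / 2 + δ / 2 := by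
        have hi4 : Integrable (fun p => |W.toFun p - g p| / 2 + |W.toFun p - g p.swap| / 2)
          volume := (hi1.div_const 2).add (hi2.div_const 2)
        rw [integral_add hi4 (integrable_const _),
          integral_add (hi1.div_const 2) (hi2.div_const 2), integral_div, integral_div]
        simp
    _ ≤ δ := by
        rw [W.integral_swap_abs_sub (g := g)]
        simp only [Real.norm_eq_abs] at hg
        linarith

/-! ### Sorting the cells by colour -/

theorem exists_equiv_monotone_symm {M : ℕ} {α : Type*} [LinearOrder α]
    (col : Fin M × Fin M → α) :
    ∃ σ : Fin M × Fin M ≃ Fin (M * M), Monotone fun s => col (σ.symm s) :=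
  ⟨finProdFinEquiv.trans (Tuple.sort (col ∘ finProdFinEquiv.symm)).symm,
    Tuple.monotone_sort (col ∘ finProdFinEquiv.symm)⟩

theorem card_filter_fst_lt {M k : ℕ} (hk : k ≤ M) :
    (Finset.univ.filter fun c : Fin M × Fin M => (c.1 : ℕ) < k).card = k * M := by
  have h : (Finset.univ.filter fun c : Fin M × Fin M => (c.1 : ℕ) < k)
      = (Finset.univ.filter fun i : Fin M => (i : ℕ) < k) ×ˢ Finset.univ := by
    ext c
    simp
  rw [h, Finset.card_product, Fin.card_filter_val_lt, min_eq_right hk, Finset.card_univ,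
    Fintype.card_fin]

/-- Counting: all cells of strictly earlier strips come before `c` in the sorted order, and all
cells up to `c` lie in its strip or earlier ones. A union of the first `a` strips has `a * q * (m *
q)` cells. -/
theorem strip_bounds_of_monotone {m q : ℕ} (hq : 0 < q)
    (σ : Fin (m * q) × Fin (m * q) ≃ Fin (m * q * (m * q)))
    (hσ : Monotone fun s => ((σ.symm s).1 : ℕ) / q) (c : Fin (m * q) × Fin (m * q)) :
    (c.1 : ℕ) / q * q * (m * q) ≤ σ c ∧
      (σ c : ℕ) + 1 ≤ ((c.1 : ℕ) / q + 1) * q * (m * q) := by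
  have ha : (c.1 : ℕ) / q < m := (Nat.div_lt_iff_lt_mul hq).2 c.1.2
  constructor
  · rw [← card_filter_fst_lt (M := m * q) (Nat.mul_le_mul_right q ha.le),
      ← Fin.card_Iio (σ c)]
    refine Finset.card_le_card_of_injOn σ ?_ σ.injective.injOn
    intro d hd
    have hd' : (d.1 : ℕ) < (c.1 : ℕ) / q * q := by simpa using hd
    have hd2 : (d.1 : ℕ) / q < (c.1 : ℕ) / q := (Nat.div_lt_iff_lt_mul hq).2 hd'
    simp only [Finset.coe_Iio, Set.mem_Iio]
    by_contra hlt
    have := hσ (not_lt.1 hlt)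
    simp only [Equiv.symm_apply_apply] at this
    omega
  · rw [← card_filter_fst_lt (M := m * q) (Nat.mul_le_mul_right q ha), ← Fin.card_Iic (σ c)]
    refine Finset.card_le_card_of_injOn σ.symm ?_ σ.symm.injective.injOn
    intro s hs
    have hs' : s ≤ σ c := by simpa using hs
    have := hσ hs'
    simp only [Equiv.symm_apply_apply] at this
    have h2 : ((σ.symm s).1 : ℕ) < ((c.1 : ℕ) / q + 1) * q :=
      (Nat.div_lt_iff_lt_mul hq).1 (by omega)
    simpa using h2

theorem shift_rearrange_le {m q : ℕ} (hm : 0 < m) (hq : 0 < q)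
    (σ : Fin (m * q) × Fin (m * q) ≃ Fin (m * q * (m * q)))
    (hσ : Monotone fun s => ((σ.symm s).1 : ℕ) / q) :
    (rearrange (Nat.mul_pos hm hq) σ).shift ≤ 1 / m := by
  have hm' : (0 : ℝ) < m := Nat.cast_pos.2 hm
  have hq' : (0 : ℝ) < q := Nat.cast_pos.2 hq
  refine ciSup_le fun v => ?_
  rw [rearrange_apply]
  by_cases hv : 0 < v.1 ∧ 0 < v.2
  · rw [cellsToSlices, if_pos hv, coe_blockPoint]
    set c := (blockIndex (Nat.mul_pos hm hq) v.1, blockIndex (Nat.mul_pos hm hq) v.2) with hc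
    obtain ⟨h1, h2⟩ := strip_bounds_of_monotone hq σ hσ c
    obtain ⟨h3, h4⟩ := blockIndex_spec (Nat.mul_pos hm hq) hv.1
    have h5 : (c.1 : ℕ) / q * q ≤ c.1 := Nat.div_mul_le_self _ _
    have h6 : (c.1 : ℕ) + 1 ≤ ((c.1 : ℕ) / q + 1) * q := Nat.lt_div_mul_add hq |>.trans_eq (by ring)
    set a := (c.1 : ℕ) / q
    have h1' : (a : ℝ) * q * (m * q) ≤ ((σ c : ℕ) : ℝ) := by exact_mod_cast h1
    have h2' : ((σ c : ℕ) : ℝ) + 1 ≤ ((a : ℝ) + 1) * q * (m * q) := by exact_mod_cast h2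
    have h5' : (a : ℝ) * q ≤ ((c.1 : ℕ) : ℝ) := by exact_mod_cast h5
    have h6' : ((c.1 : ℕ) : ℝ) + 1 ≤ ((a : ℝ) + 1) * q := by exact_mod_cast h6
    have hf0 := (blockFrac (Nat.mul_pos hm hq) v.1).2.1
    have hf1 := (blockFrac (Nat.mul_pos hm hq) v.1).2.2
    set y := (((σ c : ℕ) : ℝ) + (blockFrac (Nat.mul_pos hm hq) v.1 : ℝ))
      / ((m * q * (m * q) : ℕ) : ℝ) with hy
    -- Both the old and the new abscissa lie in the strip `[a / m, (a + 1) / m]`.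
    have hy1 : (a : ℝ) / m ≤ y := by
      rw [hy, div_le_div_iff₀ hm' (by positivity)]
      push_cast
      nlinarith
    have hy2 : y ≤ ((a : ℝ) + 1) / m := by
      rw [hy, div_le_div_iff₀ (by positivity) hm']
      push_cast
      nlinarith
    push_cast at h3 h4
    have hx1 : (a : ℝ) / m ≤ (v.1 : ℝ) := by
      rw [div_le_iff₀ hm']
      refine le_of_mul_le_mul_right ?_ hq'
      linarith
    have hx2 : (v.1 : ℝ) ≤ ((a : ℝ) + 1) / m := by
      rw [le_div_iff₀ hm']
      refine le_of_mul_le_mul_right ?_ hq'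
      linarith
    rw [add_div] at hy2 hx2
    exact abs_le.2 ⟨by linarith, by linarith⟩
  · rw [cellsToSlices, if_neg hv]
    simp

/-! ### Monotone colourings of the interval are nearly constant on short blocks -/

/-- On a bad block the colour at the right end strictly exceeds the colour at some earlier point of
the block, hence also the right-end colour of every previous block. Right-end colours of bad blocks
therefore increase strictly, and there are only `k` colours. -/
theorem volume_not_constant_on_block_le {k L : ℕ} (hL : 0 < L) {c : unitInterval → Fin k}
    (hc : ∀ x y, 0 < x → x ≤ y → c x ≤ c y) :
    volume.real {x | 0 < x ∧ c x ≠ c (blockPoint (blockIndex hL x) 1)} ≤ (k : ℝ) / L := by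
  classical
  have hL' : (0 : ℝ) < L := Nat.cast_pos.2 hL
  let bad : Finset (Fin L) := Finset.univ.filter fun a =>
    ∃ x, 0 < x ∧ blockIndex hL x = a ∧ c x ≠ c (blockPoint a 1)
  have hle : ∀ x, 0 < x → x ≤ blockPoint (blockIndex hL x) 1 := by
    intro x hx
    have h : (x : ℝ) ≤ (blockPoint (blockIndex hL x) 1 : ℝ) := by
      rw [coe_blockPoint, le_div_iff₀ hL', Icc.coe_one]
      linarith [(blockIndex_spec hL hx).2]
    exact h
  have hmono : ∀ a ∈ bad, ∀ b ∈ bad, a < b → c (blockPoint a 1) < c (blockPoint b 1) := by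
    intro a _ b hb hab
    obtain ⟨x, hx, rfl, hne⟩ := (Finset.mem_filter.1 hb).2
    have h1 : blockPoint a 1 ≤ x := by
      have h : (blockPoint a 1 : ℝ) ≤ x := by
        rw [coe_blockPoint, div_le_iff₀ hL', Icc.coe_one]
        have h2 := (blockIndex_spec hL hx).1
        have h3 : ((a : ℕ) : ℝ) + 1 ≤ ((blockIndex hL x : ℕ) : ℝ) := by
          exact_mod_cast Fin.lt_def.1 hab
        linarith
      exact h
    exact (hc _ _ (blockPoint_pos a zero_lt_one) h1).trans_lt
      (lt_of_le_of_ne (hc _ _ hx (hle x hx)) hne)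
  have hcard : bad.card ≤ k := by
    calc bad.card ≤ (Finset.univ : Finset (Fin k)).card := by
          refine Finset.card_le_card_of_injOn (fun a => c (blockPoint a 1))
            (fun _ _ => Finset.mem_coe.2 (Finset.mem_univ _)) ?_
          intro a ha b hb hab
          rcases lt_trichotomy a b with h | h | h
          · exact absurd hab (hmono a ha b hb h).ne
          · exact h
          · exact absurd hab (hmono b hb a ha h).ne'
      _ = k := by simp
  have hsub : {x | 0 < x ∧ c x ≠ c (blockPoint (blockIndex hL x) 1)}
      ⊆ ⋃ a ∈ bad, blockIndex hL ⁻¹' {a} := by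
    rintro x ⟨hx, hne⟩
    simp only [mem_iUnion]
    exact ⟨blockIndex hL x, Finset.mem_filter.2 ⟨Finset.mem_univ _, x, hx, rfl, hne⟩, rfl⟩
  calc _ ≤ volume.real (⋃ a ∈ bad, blockIndex hL ⁻¹' {a}) :=
        measureReal_mono hsub (measure_ne_top _ _)
    _ ≤ ∑ a ∈ bad, volume.real (blockIndex hL ⁻¹' {a}) := measureReal_biUnion_finset_le _ _
    _ = bad.card * (L : ℝ)⁻¹ := by
        simp only [measureReal_def, volume_blockIndex_preimage, ENNReal.toReal_inv,
          ENNReal.toReal_natCast, Finset.sum_const, nsmul_eq_mul]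
    _ ≤ (k : ℝ) / L := by
        rw [div_eq_mul_inv]
        gcongr

theorem divNat_blockIndex {L P : ℕ} (hL : 0 < L) (h : 0 < L * P) {x : unitInterval}
    (hx : 0 < x) : (blockIndex h x).divNat = blockIndex hL x := by
  have hP : 0 < P := Nat.pos_of_mul_pos_left h
  have hP' : (0 : ℝ) < P := Nat.cast_pos.2 hP
  symm
  rw [blockIndex_eq_iff hL hx]
  obtain ⟨h1, h2⟩ := blockIndex_spec h hx
  set i := blockIndex h x
  have h3 : ((i.divNat : ℕ) : ℝ) * P ≤ ((i : ℕ) : ℝ) := by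
    exact_mod_cast Nat.div_mul_le_self (i : ℕ) P
  have h4 : ((i : ℕ) : ℝ) + 1 ≤ (((i.divNat : ℕ) : ℝ) + 1) * P := by
    have : (i : ℕ) + 1 ≤ ((i.divNat : ℕ) + 1) * P :=
      (Nat.lt_div_mul_add hP).trans_eq (by rw [add_mul, one_mul]; rfl)
    exact_mod_cast this
  push_cast at h1 h2
  constructor
  · refine lt_of_mul_lt_mul_right ?_ hP'.le
    linarith
  · refine le_of_mul_le_mul_right ?_ hP'
    linarith

/-! ### Approximating orderons by graphs -/

theorem integral_abs_le_of_ae_eq_zero_off {H : UnitSquare × UnitSquare → ℝ}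
    (hH : Integrable H volume) (hH1 : ∀ p, |H p| ≤ 1) {Z : Set UnitSquare} (hZ : MeasurableSet Z)
    (h0 : ∀ᵐ p : UnitSquare × UnitSquare, p.1 ∉ Z → p.2 ∉ Z → H p = 0) :
    ∫ p, |H p| ≤ 2 * volume.real Z := by
  have hm : MeasurableSet (Z ×ˢ univ ∪ univ ×ˢ Z : Set (UnitSquare × UnitSquare)) :=
    (hZ.prod MeasurableSet.univ).union (MeasurableSet.univ.prod hZ)
  calc ∫ p, |H p| ≤ ∫ p, (Z ×ˢ univ ∪ univ ×ˢ Z).indicator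
          (1 : UnitSquare × UnitSquare → ℝ) p := by
        refine integral_mono_ae hH.abs ((integrable_const (1 : ℝ)).indicator hm) ?_
        filter_upwards [h0] with p hp
        by_cases hpZ : p ∈ (Z ×ˢ univ ∪ univ ×ˢ Z : Set (UnitSquare × UnitSquare))
        · rw [indicator_of_mem hpZ]
          exact hH1 p
        · rw [indicator_of_notMem hpZ, hp (fun h => hpZ (Or.inl ⟨h, mem_univ _⟩))
            (fun h => hpZ (Or.inr ⟨mem_univ _, h⟩)), abs_zero]
    _ = volume.real (Z ×ˢ univ ∪ univ ×ˢ Z : Set (UnitSquare × UnitSquare)) :=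
        integral_indicator_one hm
    _ ≤ volume.real (Z ×ˢ univ : Set (UnitSquare × UnitSquare))
          + volume.real (univ ×ˢ Z : Set (UnitSquare × UnitSquare)) := measureReal_union_le _ _
    _ = 2 * volume.real Z := by
        rw [Measure.volume_eq_prod, measureReal_prod_prod, measureReal_prod_prod]
        simp
        ring

theorem Orderon.exists_graph_cutShiftDist_le (W : Orderon) {m r L p : ℕ} (hm : 0 < m)
    (hL : 0 < L) [Fact p.Prime] {β δ γ : ℝ} (hβ : 0 < β) (hδ : 0 ≤ δ) (hr : 1 < r * δ ^ 2)
    (hγ : 0 ≤ γ) (hγp : 2 ≤ γ ^ 2 * p) (hn : 0 < L * (p * p)) :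
    ∃ G : SimpleGraph (Fin (L * (p * p))),
      cutShiftDist W (Orderon.ofGraph hn G) ≤ 1 / m + β + δ + 2 * (((m * 4 ^ r : ℕ) : ℝ) / L)
        + (γ + 1 / ((L * (p * p) : ℕ) : ℝ)) := by
  classical
  obtain ⟨M₀, hM₀⟩ := W.exists_grid_approx hβ
  -- With `q = M₀ + 1`, the grid size `m * q` is fine enough and the strips of width `1 / m` are
  -- unions of grid columns.
  have hq : 0 < M₀ + 1 := Nat.succ_pos _
  have hM : 0 < m * (M₀ + 1) := Nat.mul_pos hm hq
  set M := m * (M₀ + 1) with hMdef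
  obtain ⟨w, hw, hw0, hw1, hwW⟩ := hM₀ M hM
    ((Nat.le_succ _).trans (Nat.le_mul_of_pos_left _ hm))
  have : Nonempty (Fin M × Fin M) := ⟨(⟨0, hM⟩, ⟨0, hM⟩)⟩
  obtain ⟨κ, g, hg, hg0, hg1, hgw⟩ := exists_weakly_regular_coloring hw hw0 hw1
    (fun c : Fin M × Fin M => (⟨(c.1 : ℕ) / (M₀ + 1), (Nat.div_lt_iff_lt_mul hq).2 c.1.2⟩ : Fin m))
    hδ hr
  set κ₀ : Fin M × Fin M → Fin m := fun c =>
    ⟨(c.1 : ℕ) / (M₀ + 1), (Nat.div_lt_iff_lt_mul hq).2 c.1.2⟩ with hκ₀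
  -- `finProdFinEquiv` makes the strip the leading digit, so sorting by colour also sorts by strip.
  let col : Fin M × Fin M → Fin (m * 4 ^ r) := fun c => finProdFinEquiv (κ₀ c, κ c)
  let g' : Fin (m * 4 ^ r) → Fin (m * 4 ^ r) → ℝ := fun a b =>
    g (finProdFinEquiv.symm a) (finProdFinEquiv.symm b)
  have hg'col : ∀ c d, g' (col c) (col d) = g (κ₀ c, κ c) (κ₀ d, κ d) := fun c d => by
    simp only [g', col, Equiv.symm_apply_apply]
  obtain ⟨σ, hσ⟩ := exists_equiv_monotone_symm col
  have hcol0 : ∀ c, (col c : ℕ) / 4 ^ r = (c.1 : ℕ) / (M₀ + 1) := fun c => by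
    have h : (col c).divNat = κ₀ c :=
      congrArg Prod.fst (finProdFinEquiv.symm_apply_apply (κ₀ c, κ c))
    exact congrArg Fin.val h
  have hstrip : Monotone fun s => ((σ.symm s).1 : ℕ) / (M₀ + 1) := fun s s' hs => by
    have := Nat.div_le_div_right (c := 4 ^ r) (Fin.le_def.1 (hσ hs))
    simpa only [hcol0] using this
  have hshift := shift_rearrange_le hm hq σ hstrip
  set f := rearrange hM σ with hf
  let c : unitInterval → Fin (m * 4 ^ r) := fun x =>
    col (σ.symm (blockIndex (Nat.mul_pos hM hM) x))
  have hcmono : ∀ x y, 0 < x → x ≤ y → c x ≤ c y := fun x y hx hxy =>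
    hσ (blockIndex_mono _ hx hxy)
  have hcmeas : Measurable c :=
    (measurable_of_countable fun s => col (σ.symm s)).comp (measurable_blockIndex _)
  let cg : Fin L → Fin (m * 4 ^ r) := fun a => c (blockPoint a 1)
  let θ : Fin L → Fin L → ℝ := fun a b => g' (cg a) (cg b)
  let e : Fin (p * p) ≃ ZMod p × ZMod p := Fintype.equivOfCardEq (by simp [ZMod.card])
  have hθ : ∀ a b, θ a b = θ b a := fun a b => hg _ _
  refine ⟨quasirandomGraph hθ e, ?_⟩
  set G := quasirandomGraph hθ e with hG
  let α : UnitSquare → Fin (L * (p * p)) := fun v => blockIndex hn v.1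
  have hα : Measurable α := (measurable_blockIndex hn).comp measurable_fst
  let B : UnitSquare × UnitSquare → ℝ := fun p => w (gridCell hM p.1) (gridCell hM p.2)
  let C : UnitSquare × UnitSquare → ℝ := fun p =>
    g' (col (gridCell hM p.1)) (col (gridCell hM p.2))
  let C' : UnitSquare × UnitSquare → ℝ := fun p => g' (c p.1.1) (c p.2.1)
  let D : UnitSquare × UnitSquare → ℝ := fun p => θ (α p.1).divNat (α p.2).divNat
  have hBi : Integrable B volume := integrable_step (measurable_gridCell hM) w
  have hCi : Integrable C volume :=
    integrable_step (measurable_gridCell hM) fun a b => g' (col a) (col b)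
  have hC'i : Integrable C' volume := integrable_step (hcmeas.comp measurable_fst) g'
  have hDi : Integrable D volume := integrable_step hα fun i j => θ i.divNat j.divNat
  have hEi := (Orderon.ofGraph hn G).integrable
  have hpull : ∀ {H : UnitSquare × UnitSquare → ℝ}, Integrable H volume →
      Integrable (fun p : UnitSquare × UnitSquare => H (f.toFun p.1, f.toFun p.2)) volume :=
    fun {H} hH => by
    have hH' : Integrable H (Measure.map (Prod.map f.toFun f.toFun) volume) := by
      rwa [f.preserving.prod_map_eq]
    exact hH'.comp_aemeasurable f.preserving.prod_aemeasurable
  have hWB : cutNorm (fun p => W.toFun p - B p) ≤ β :=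
    (cutNorm_le_integral_abs (W.integrable.sub hBi)).trans hwW
  have hBC : cutNorm (fun p => B p - C p) ≤ δ := by
    refine cutNorm_step_le (measurable_gridCell hM) (N := (M : ℝ) ^ 2) (by positivity)
      (fun i => (volume_gridCell_preimage hM i).le) (h := fun i j => w i j - g' (col i) (col j))
      fun s t hs0 hs1 ht0 ht1 => ?_
    have h := hgw s t hs0 hs1 ht0 ht1
    simp only [hg'col]
    refine h.trans_eq ?_
    simp only [Fintype.card_prod, Fintype.card_fin]
    push_cast
    ring
  -- No error here: off the axes, `f` carries each cell into the slice that has its colour.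
  have hCC' : cutNorm (fun p => C p - C' (f.toFun p.1, f.toFun p.2)) ≤ 0 := by
    refine (cutNorm_le_integral_abs (hCi.sub (hpull hC'i))).trans_eq ?_
    rw [integral_eq_zero_of_ae]
    have hslice : ∀ v : UnitSquare, 0 < v.1 ∧ 0 < v.2 →
        c (f.toFun v).1 = col (gridCell hM v) := fun v hv => by
      rw [hf, rearrange_apply, cellsToSlices, if_pos hv]
      simp only [c, blockIndex_blockPoint _ _ (blockFrac_pos hM hv.1), Equiv.symm_apply_apply]
      rfl
    filter_upwards [ae_pos_unitSquare_prod] with p hp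
    have h : C p = C' (f.toFun p.1, f.toFun p.2) := by
      simp only [C, C', hslice p.1 hp.1, hslice p.2 hp.2]
    simp [h]
  have hC'D : cutNorm (fun p => C' p - D p) ≤ 2 * (((m * 4 ^ r : ℕ) : ℝ) / L) := by
    have hbad := volume_not_constant_on_block_le hL hcmono
    set Y := {x | 0 < x ∧ c x ≠ c (blockPoint (blockIndex hL x) 1)} with hY
    have hYm : MeasurableSet Y := by
      refine measurableSet_Ioi.inter (measurableSet_eq_fun hcmeas ?_).compl
      exact (measurable_of_countable cg).comp (measurable_blockIndex hL)
    have hYvol : volume.real (Y ×ˢ univ : Set UnitSquare) = volume.real Y := by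
      rw [Measure.volume_eq_prod, measureReal_prod_prod]
      simp
    refine (cutNorm_le_integral_abs (hC'i.sub hDi)).trans
      ((integral_abs_le_of_ae_eq_zero_off (hC'i.sub hDi) (fun p => ?_)
        (hYm.prod MeasurableSet.univ) ?_).trans ?_)
    · have h1 := hg0 (finProdFinEquiv.symm (c p.1.1)) (finProdFinEquiv.symm (c p.2.1))
      have h2 := hg1 (finProdFinEquiv.symm (c p.1.1)) (finProdFinEquiv.symm (c p.2.1))
      have h3 := hg0 (finProdFinEquiv.symm (cg (α p.1).divNat))
        (finProdFinEquiv.symm (cg (α p.2).divNat))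
      have h4 := hg1 (finProdFinEquiv.symm (cg (α p.1).divNat))
        (finProdFinEquiv.symm (cg (α p.2).divNat))
      exact abs_le.2 ⟨by simp only [Pi.sub_apply, C', D, θ, g']; linarith,
        by simp only [Pi.sub_apply, C', D, θ, g']; linarith⟩
    · filter_upwards [ae_pos_unitSquare_prod] with p hp h1 h2
      have hgood : ∀ v : UnitSquare, 0 < v.1 → v ∉ (Y ×ˢ univ : Set UnitSquare) →
          c v.1 = cg (α v).divNat := fun v hv hvY => by
        simp only [α, divNat_blockIndex hL hn hv]
        by_contra hne
        exact hvY ⟨⟨hv, hne⟩, mem_univ _⟩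
      simp only [Pi.sub_apply, C', D, θ, hgood p.1 hp.1.1 h1, hgood p.2 hp.2.1 h2, sub_self]
    · rw [hYvol]
      exact mul_le_mul_of_nonneg_left hbad zero_le_two
  have hDE : cutNorm (fun p => D p - (Orderon.ofGraph hn G).toFun p)
      ≤ γ + 1 / ((L * (p * p) : ℕ) : ℝ) := by
    have hn' : (0 : ℝ) < ((L * (p * p) : ℕ) : ℝ) := Nat.cast_pos.2 hn
    rw [cutNorm_sub_comm]
    refine cutNorm_step_le hα hn' (fun i => ?_)
      (h := fun i j => (if G.Adj i j then 1 else 0) - θ i.divNat j.divNat)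
      fun s t hs0 hs1 ht0 ht1 => ?_
    · have h : α ⁻¹' {i} = (blockIndex hn ⁻¹' {i}) ×ˢ univ := by
        ext v
        simp [α]
      rw [h, Measure.volume_eq_prod, measureReal_prod_prod, measureReal_def,
        volume_blockIndex_preimage, ENNReal.toReal_inv, ENNReal.toReal_natCast]
      simp
    · refine (abs_sum_quasirandomGraph_le hθ (fun _ _ => hg0 _ _) (fun _ _ => hg1 _ _) e hγ hγp
        hs0 hs1 ht0 ht1).trans_eq ?_
      field_simp
  refine (cutShiftDist_le W _ f).trans ?_
  have t1 := cutNorm_sub_triangle W.integrable hBi (hpull hEi)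
  have t2 := cutNorm_sub_triangle hBi hCi (hpull hEi)
  have t3 := cutNorm_sub_triangle hCi (hpull hC'i) (hpull hEi)
  -- From here on the comparison takes place in the rearranged square, where `C'`, `D` and the graph
  -- depend on first coordinates only.
  have t4 := cutNorm_pullback_le (hC'i.sub hEi) f
  have t5 := cutNorm_sub_triangle hC'i hDi hEi
  have t6 : cutNorm (fun p => W.toFun p - ((Orderon.ofGraph hn G).pullback f).toFun p)
      ≤ β + δ + 2 * (((m * 4 ^ r : ℕ) : ℝ) / L) + (γ + 1 / ((L * (p * p) : ℕ) : ℝ)) := by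
    refine t1.trans ?_
    simp only [Pi.sub_def] at t4
    linarith
  linarith

/-! ### Choice of parameters, the vertex bound and density -/

theorem cutShiftDist_le_one (W U : Orderon) : cutShiftDist W U ≤ 1 := by
  refine (cutShiftDist_le W U MPBijection.refl).trans ?_
  rw [MPBijection.shift_refl, zero_add]
  refine (cutNorm_le_integral_abs
    (W.integrable.sub (U.pullback MPBijection.refl).integrable)).trans ?_
  calc _ ≤ ∫ _p : UnitSquare × UnitSquare, (1 : ℝ) := by
        refine integral_mono (W.integrable.sub (U.pullback MPBijection.refl).integrable).abs
          (integrable_const _) fun p => ?_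
        have h1 := W.mem_Icc' p
        have h2 := (U.pullback MPBijection.refl).mem_Icc' p
        exact abs_le.2 ⟨by simp only [Pi.sub_apply]; linarith [h1.1, h2.2],
          by simp only [Pi.sub_apply]; linarith [h1.2, h2.1]⟩
    _ = 1 := by simp

/-- Every orderon is within `1 / d` of the orderon of a graph on `2 ^ O(d ^ 2)` vertices. -/
theorem Orderon.exists_graph_card_le_two_pow (W : Orderon) {d : ℕ} (hd : 0 < d) :
    ∃ (n : ℕ) (hn : 0 < n) (G : SimpleGraph (Fin n)),
      n ≤ 2 ^ (159 * d ^ 2) ∧ cutShiftDist W (Orderon.ofGraph hn G) ≤ 1 / d := by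
  obtain ⟨p, hp, hp1, hp2⟩ := Nat.exists_prime_lt_and_le_two_mul (128 * d ^ 2) (by positivity)
  have : Fact p.Prime := ⟨hp⟩
  -- Each of the six error terms is made at most `1 / (8 * d)`. The `+ 1` makes `r * δ ^ 2` strictly
  -- exceed `1`, `L` is `16 * d` times the number of colours, and the prime above `128 * d ^ 2` from
  -- Bertrand's postulate gives `2 ≤ γ ^ 2 * p`.
  set r := 64 * d ^ 2 + 1 with hr
  set L := 16 * d * (8 * d * 4 ^ r) with hL
  have hL0 : 0 < L := by positivity
  have hn : 0 < L * (p * p) := by have := hp.pos; positivity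
  have hd' : (1 : ℝ) ≤ d := by exact_mod_cast hd
  have hp1' : (128 : ℝ) * d ^ 2 ≤ p := by exact_mod_cast hp1.le
  obtain ⟨G, hG⟩ := W.exists_graph_cutShiftDist_le (m := 8 * d) (r := r) (L := L) (p := p)
    (β := 1 / (8 * d)) (δ := 1 / (8 * d)) (γ := 1 / (8 * d)) (by positivity) hL0 (by positivity)
    (by positivity)
    (by
      rw [hr, one_div, inv_pow, ← div_eq_mul_inv, lt_div_iff₀ (by positivity)]
      push_cast
      nlinarith)
    (by positivity)
    (by
      rw [one_div, inv_pow, inv_mul_eq_div, le_div_iff₀ (by positivity)]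
      linarith) hn
  refine ⟨L * (p * p), hn, G, ?_, hG.trans ?_⟩
  -- The constant is `159 = 25 + 128 + 6`, the last summand absorbing `d ^ 6`.
  · have hdpow : d ≤ 2 ^ (d ^ 2) := (Nat.lt_two_pow_self).le.trans
      (Nat.pow_le_pow_right two_pos (Nat.le_self_pow two_ne_zero d))
    have h1 : L * (p * p) ≤ 2 ^ 25 * 2 ^ (128 * d ^ 2) * d ^ 6 := by
      calc L * (p * p) ≤ L * ((2 * (128 * d ^ 2)) * (2 * (128 * d ^ 2))) := by gcongr
        _ = 2 ^ 25 * 2 ^ (128 * d ^ 2) * d ^ 6 := by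
            have h4 : (4 : ℕ) ^ r = 4 * 2 ^ (128 * d ^ 2) := by
              rw [hr, pow_succ, show (4 : ℕ) = 2 ^ 2 by norm_num, ← pow_mul]
              ring_nf
            rw [hL, h4]
            ring
    calc L * (p * p) ≤ 2 ^ 25 * 2 ^ (128 * d ^ 2) * d ^ 6 := h1
      _ ≤ 2 ^ (25 * d ^ 2) * 2 ^ (128 * d ^ 2) * (2 ^ (d ^ 2)) ^ 6 := by
          gcongr
          · norm_num
          · nlinarith
      _ = 2 ^ (159 * d ^ 2) := by
          rw [← pow_mul, ← pow_add, ← pow_add]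
          ring_nf
  · have h1 : (((8 * d * 4 ^ r : ℕ) : ℝ) / (L : ℝ)) = 1 / (16 * d) := by
      rw [hL]
      push_cast
      field_simp
    have h2 : 1 / ((L * (p * p) : ℕ) : ℝ) ≤ 1 / (8 * d) := by
      have h3 : 8 * d ≤ L * (p * p) := by
        have h5 : 8 * d ≤ 8 * d * 4 ^ r := Nat.le_mul_of_pos_right _ (by positivity)
        have h6 : 8 * d * 4 ^ r ≤ L := Nat.le_mul_of_pos_left _ (by positivity)
        have h7 : L ≤ L * (p * p) := Nat.le_mul_of_pos_right _ (Nat.mul_pos hp.pos hp.pos)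
        omega
      have h3' : (8 : ℝ) * d ≤ ((L * (p * p) : ℕ) : ℝ) := by exact_mod_cast h3
      exact one_div_le_one_div_of_le (by positivity) h3'
    rw [h1]
    have h4 : (1 : ℝ) / (16 * d) = 1 / d / 16 := by field_simp
    have h5 : (1 : ℝ) / (8 * d) = 1 / d / 8 := by field_simp
    have h6 : (0 : ℝ) < 1 / d := by positivity
    push_cast at h2 ⊢
    rw [h4]
    rw [h5] at h2 ⊢
    linarith

/-- There is an error exponent `η(ε) → 0` as `ε → 0⁺`, not depending on the orderon, such that every
orderon `W` is within cut-shift distance `ε` of `W_G` for a simple ordered graph `G` with at most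
`2 ^ (ε ^ (-3 + η(ε)))` vertices; in particular the orderons of simple ordered graphs are dense. -/
theorem corollary4 :
    (∃ η : ℝ → ℝ, Tendsto η (𝓝[>] (0 : ℝ)) (𝓝 0) ∧
      ∀ (W : Orderon) (ε : ℝ), 0 < ε →
        ∃ (n : ℕ) (hn : 0 < n) (G : SimpleGraph (Fin n)),
          (n : ℝ) ≤ (2 : ℝ) ^ (ε ^ (-3 + η ε)) ∧
          cutShiftDist W (Orderon.ofGraph hn G) ≤ ε) ∧
    Dense {U : Orderon | ∃ (n : ℕ) (hn : 0 < n) (G : SimpleGraph (Fin n)),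
      U = Orderon.ofGraph hn G} := by
  classical
  have happrox : ∀ (W : Orderon) (ε : ℝ), 0 < ε → ε < 1 →
      ∃ (n : ℕ) (hn : 0 < n) (G : SimpleGraph (Fin n)),
        (n : ℝ) ≤ (2 : ℝ) ^ (636 * ε⁻¹ ^ 2) ∧ cutShiftDist W (Orderon.ofGraph hn G) ≤ ε := by
    intro W ε hε hε1
    have hinv : 1 ≤ ε⁻¹ := (one_le_inv₀ hε).2 hε1.le
    have hd : 0 < ⌈ε⁻¹⌉₊ := Nat.ceil_pos.2 (by positivity)
    have hd1 := Nat.le_ceil ε⁻¹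
    -- Rounding up at most doubles `ε⁻¹`, as `ε < 1`; hence `636 = 4 * 159`.
    have hd2 : (⌈ε⁻¹⌉₊ : ℝ) ≤ 2 * ε⁻¹ := by
      have := Nat.ceil_lt_add_one (by positivity : 0 ≤ ε⁻¹)
      linarith
    obtain ⟨n, hn, G, hnle, hG⟩ := W.exists_graph_card_le_two_pow hd
    refine ⟨n, hn, G, ?_, hG.trans ?_⟩
    · calc (n : ℝ) ≤ (2 : ℝ) ^ (159 * ⌈ε⁻¹⌉₊ ^ 2) := by exact_mod_cast hnle
        _ = (2 : ℝ) ^ (159 * (⌈ε⁻¹⌉₊ : ℝ) ^ 2) := by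
            rw [← Real.rpow_natCast]
            push_cast
            rfl
        _ ≤ (2 : ℝ) ^ (636 * ε⁻¹ ^ 2) := by
            refine Real.rpow_le_rpow_of_exponent_le one_le_two ?_
            nlinarith [pow_le_pow_left₀ (Nat.cast_nonneg _) hd2 2]
    · rw [one_div]
      exact inv_le_of_inv_le₀ hε hd1
  -- For `ε ≤ 1 / 636` the bound `636 * ε⁻¹ ^ 2 ≤ ε⁻¹ ^ 3` allows `η = 0`, so the limit is trivial.
  -- In the middle range `η` is chosen to make `ε ^ (-3 + η ε)` equal to `636 * ε⁻¹ ^ 2`. For `1 ≤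
  -- ε` a single vertex is enough, since all distances are at most `1`.
  refine ⟨⟨fun ε => if 1 / 636 < ε ∧ ε < 1 then 3 + Real.logb ε (636 * ε⁻¹ ^ 2) else 0,
    ?_, ?_⟩, ?_⟩
  · refine Tendsto.congr' ?_ tendsto_const_nhds
    have h : ∀ᶠ ε : ℝ in 𝓝[>] 0, ε < 1 / 636 :=
      mem_nhdsWithin_of_mem_nhds (Iio_mem_nhds (by norm_num))
    filter_upwards [h] with ε hε
    rw [if_neg fun h' => absurd h'.1 (not_lt.2 hε.le)]
  · intro W ε hε
    rcases lt_or_ge ε 1 with hε1 | hε1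
    · obtain ⟨n, hn, G, hnle, hG⟩ := happrox W ε hε hε1
      refine ⟨n, hn, G, hnle.trans (Real.rpow_le_rpow_of_exponent_le one_le_two ?_), hG⟩
      dsimp only
      by_cases h : 1 / 636 < ε
      · rw [if_pos ⟨h, hε1⟩, neg_add_cancel_left, Real.rpow_logb hε hε1.ne (by positivity)]
      · rw [if_neg fun h' => h h'.1, add_zero, Real.rpow_neg hε.le, ← Real.inv_rpow hε.le,
          show (3 : ℝ) = ((3 : ℕ) : ℝ) by norm_num, Real.rpow_natCast, pow_succ' ε⁻¹ 2]
        have h636 : (636 : ℝ) ≤ ε⁻¹ := by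
          rw [le_inv_comm₀ (by norm_num) hε]
          linarith
        gcongr
    · refine ⟨1, one_pos, ⊥, ?_, (cutShiftDist_le_one _ _).trans hε1⟩
      rw [Nat.cast_one]
      exact Real.one_le_rpow one_le_two (Real.rpow_nonneg hε.le _)
  · rw [Metric.dense_iff]
    intro W ρ hρ
    have hε : 0 < min (ρ / 2) (1 / 2) := lt_min (by positivity) (by norm_num)
    obtain ⟨n, hn, G, -, hG⟩ := happrox W _ hε ((min_le_right _ _).trans_lt (by norm_num))
    refine ⟨Orderon.ofGraph hn G, ?_, n, hn, G, rfl⟩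
    rw [Metric.mem_ball, dist_comm]
    exact (hG.trans (min_le_left _ _)).trans_lt (by linarith)
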